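/- **Setting.** Let $(\Gamma,d)$ be a countable metric space. For each $x\in\Gamma$ let $\mathcal H_x\neq\{0\}$ be a finite-dimensional complex Hilbert space. For finite $\Lambda\subset\Gamma$ put $\mathcal H_\Lambda=\bigotimes_{x\in\Lambda}\mathcal H_x$ and $\mathcal A_\Lambda=\mathcal B(\mathcal H_\Lambda)$ with the operator norm; for $X\subset\Lambda$, $\mathcal A_X$ is identified with $\mathcal A_X\otimes 1_{\Lambda\setminus X}\subset\mathcal A_\Lambda$. An *$F$-function* on $(\Gamma,d)$ is a non-increasing $F:[0,\infty)\to(0,\infty)$ with $\|F\|=\sup_{x\in\Gamma}\sum_{y\in\Gamma}F(d(x,y))<\infty$ for which there is $C>0$ with $\sum_{z\in\Gamma}F(d(x,z))F(d(z,y))\le C\,F(d(x,y))$ for all $x,y\in\Gamma$; $C_F$ denotes the infimum of all such $C$. A *dissipative interaction* is a family $\mathscr L=\{L_Z\}$, $Z\subset\Gamma$ finite, of linear maps $L_Z:\mathcal A_Z\to\mathcal A_Z$ of Lindblad form $$L_Z(A)=i[H,A]+\sum_{j=1}^{\ell}\Big(K_j^*AK_j-\tfrac12\{K_j^*K_j,A\}\Big),$$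 with $H=H^*$, $K_1,\dots,K_\ell\in\mathcal A_Z$, $\ell\in\mathbb N$ depending on $Z$. Its $F$-norm $\|\mathscr L\|_F$ is the infimum of all $M$ with $\sum_{Z\ni x,y}\|L_Z\|_{cb}\le M\,F(d(x,y))$ for all $x,y\in\Gamma$ ($\|\mathscr L\|_F=\infty$ if there is none), where $\|\Phi\|_{cb}=\sup_n\|\Phi\otimes\mathrm{id}_{M_n(\mathbb{C})}\|$. For finite $\Lambda$, let $\mathscr L^\Lambda=\sum_{Z\subset\Lambda}L_Z$ (each $L_Z$ extended to $L_Z\otimes\mathrm{id}$ on $\mathcal A_\Lambda$) and $T^\Lambda_t=e^{t\mathscr L^\Lambda}$, $t\ge0$. A state $\pi$ on $\mathcal A_\Lambda$ is a *local dynamical fixed-point of $\mathscr L$ with convergence governed by* $g_\Lambda:[0,\infty)\to[0,2]$ if $\pi\circ T^\Lambda_t=\pi$ for all $t\ge0$ and $|(\pi-\omega)(T^\Lambda_t(A))|\le g_\Lambda(t)\|A\|$ for all states $\omega$ on $\mathcal A_\Lambda$, all $A\in\mathcal A_\Lambda$ and all $t\ge0$. **Lemma 3.5.** Let $F_0$ be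 an $F$-function on $(\Gamma,d)$, let $a>0$, $F_a(r)=e^{-ar}F_0(r)$, and let $\mathscr L$ be a dissipative interaction with $0<\|\mathscr L\|_{F_a}<\infty$. Let $\Lambda\subset\Gamma$ be finite and let $\pi$ be a local dynamical fixed-point of $\mathscr L$ on $\mathcal A_\Lambda$ with convergence governed by $g_\Lambda$. Then for all non-empty $X,Y\subset\Lambda$ with $d(X,Y)=\min_{x\in X,y\in Y}d(x,y)>2$ and all $A\in\mathcal A_X$, $B\in\mathcal A_Y$, $$\begin{aligned}|\pi(AB)-\pi(A)\pi(B)|\le{}&2\|A\|\|B\|(|X|+|Y|)\,\|\mathscr L\|_{F_a}\|F_0\|\Big(t_a+\frac{C_{F_a}+\|F_a\|}{C_{F_a}}\int_0^{t_a}(e^{v_as}-1)\,ds\Big)e^{-\frac{a\,d(X,Y)}2}\\&+3\|A\|\|B\|\,g_\Lambda(t_a),\end{aligned}$$ where $v_a=\|\mathscr L\|_{F_a}C_{F_a}$ and $t_a=\dfrac{a\,d(X,Y)}{4v_a}$. -/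

import Mathlib

open scoped Matrix Matrix.Norms.L2Operator ComplexOrder

noncomputable section

namespace OpenSpin

/-! ### F-functions on a metric space -/

/-- `F : [0,∞) → (0,∞)` is non-increasing, uniformly summable and satisfies the convolution
condition.  The values of `F` at negative arguments are irrelevant. -/
structure IsFFunction (Γ : Type*) [MetricSpace Γ] (F : ℝ → ℝ) : Prop where
  pos : ∀ r, 0 ≤ r → 0 < F r
  antitone : AntitoneOn F (Set.Ici 0)
  summable : ∀ x : Γ, Summable fun y : Γ => F (dist x y)
  bounded : BddAbove (Set.range fun x : Γ => ∑' y : Γ, F (dist x y))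
  convolution : ∃ C : ℝ, 0 < C ∧ ∀ x y : Γ,
    (Summable fun z : Γ => F (dist x z) * F (dist z y)) ∧
      ∑' z : Γ, F (dist x z) * F (dist z y) ≤ C * F (dist x y)

/-- `‖F‖ = sup_x ∑_y F(d(x,y))`. -/
def FFunNorm (Γ : Type*) [MetricSpace Γ] (F : ℝ → ℝ) : ℝ :=
  ⨆ x : Γ, ∑' y : Γ, F (dist x y)

/-- The convolution constant `C_F`, the infimum of all admissible constants. -/
def convConst (Γ : Type*) [MetricSpace Γ] (F : ℝ → ℝ) : ℝ :=
  sInf {C : ℝ | 0 < C ∧ ∀ x y : Γ,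
    (Summable fun z : Γ => F (dist x z) * F (dist z y)) ∧
      ∑' z : Γ, F (dist x z) * F (dist z y) ≤ C * F (dist x y)}

/-- `F_a(r) = e^{-ar} F(r)`. -/
def expWeight (a : ℝ) (F : ℝ → ℝ) : ℝ → ℝ := fun r => Real.exp (-(a * r)) * F r

/-- `d(X,Y)`, the minimal distance between a point of `X` and a point of `Y`
(used for non-empty finite `X`, `Y`). -/
def setDist {Γ : Type*} [MetricSpace Γ] (X Y : Finset Γ) : ℝ :=
  ⨅ p : {x // x ∈ X} × {y // y ∈ Y}, dist (p.1 : Γ) (p.2 : Γ)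

/-! ### Maps on matrix algebras -/

/-- `Φ ⊗ id_n`: block-wise action of `Φ` on `n × n` block matrices with blocks in `M_σ(ℂ)`. -/
def ampliation {σ : Type*} (Φ : Matrix σ σ ℂ →ₗ[ℂ] Matrix σ σ ℂ) (n : ℕ) :
    Matrix (σ × Fin n) (σ × Fin n) ℂ →ₗ[ℂ] Matrix (σ × Fin n) (σ × Fin n) ℂ where
  toFun M := Matrix.of fun p q => Φ (Matrix.of fun i j => M (i, p.2) (j, q.2)) p.1 q.1
  map_add' M N := by
    ext p q
    exact congrFun (congrFun (Φ.map_add (Matrix.of fun i j => M (i, p.2) (j, q.2))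
      (Matrix.of fun i j => N (i, p.2) (j, q.2))) p.1) q.1
  map_smul' c M := by
    ext p q
    exact congrFun (congrFun (Φ.map_smul c (Matrix.of fun i j => M (i, p.2) (j, q.2))) p.1) q.1

/-- The completely bounded norm `‖Φ‖_cb = sup_n ‖Φ ⊗ id_n‖`, where all matrix algebras carry the
operator norm.  (On a full matrix algebra the supremum is always finite.) -/
def cbNorm {σ : Type*} [Fintype σ] [DecidableEq σ]
    (Φ : Matrix σ σ ℂ →ₗ[ℂ] Matrix σ σ ℂ) : ℝ :=
  ⨆ n : ℕ, ‖LinearMap.toContinuousLinearMap (ampliation Φ n)‖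

/-- `Φ` has Lindblad form. -/
def IsLindblad {σ : Type*} [Fintype σ] [DecidableEq σ]
    (Φ : Matrix σ σ ℂ →ₗ[ℂ] Matrix σ σ ℂ) : Prop :=
  ∃ H : Matrix σ σ ℂ, H.IsHermitian ∧ ∃ (ℓ : ℕ) (K : Fin ℓ → Matrix σ σ ℂ),
    ∀ A, Φ A = Complex.I • (H * A - A * H) +
      ∑ j, ((K j)ᴴ * A * K j - (1 / 2 : ℂ) • ((K j)ᴴ * K j * A + A * ((K j)ᴴ * K j)))

/-- A state: a positive linear functional of value `1` at the identity. -/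
structure IsState {σ : Type*} [Fintype σ] [DecidableEq σ]
    (ω : Matrix σ σ ℂ →ₗ[ℂ] ℂ) : Prop where
  nonneg : ∀ A, 0 ≤ ω (Aᴴ * A)
  map_one : ω 1 = 1

/-! ### The quantum spin system

The Hilbert space at `x` is `ℓ²(S x)`, `S x` indexing an orthonormal basis.  The Hilbert space of
a finite set `Λ` is then `⨂_{x ∈ Λ} ℓ²(S x) = ℓ²(∏_{x ∈ Λ} S x)`. -/

section Spin

variable {Γ : Type*} (S : Γ → Type*)

/-- Index set of the product basis of `𝓗_Λ`. -/
abbrev Config (Λ : Finset Γ) : Type _ := (x : {x // x ∈ Λ}) → S x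

/-- `𝓐_Λ = B(𝓗_Λ)`, written in the product basis, with the operator norm. -/
abbrev LocalAlg (Λ : Finset Γ) : Type _ := Matrix (Config S Λ) (Config S Λ) ℂ

variable {S}

/-- Restriction of a configuration to a smaller set. -/
def restrict {X Λ : Finset Γ} (h : X ⊆ Λ) (σ : Config S Λ) : Config S X :=
  fun x => σ ⟨x, h x.2⟩

open Classical in
/-- The configuration equal to `α` on `X` and to `σ` on `Λ \ X`. -/
def glue {X Λ : Finset Γ} (α : Config S X) (σ : Config S Λ) : Config S Λ :=
  fun x => if hx : (x : Γ) ∈ X then α ⟨x, hx⟩ else σ x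

open Classical in
/-- The inclusion `𝓐_X ⊂ 𝓐_Λ`, `A ↦ A ⊗ 1_{Λ \ X}`. -/
def embed {X Λ : Finset Γ} (h : X ⊆ Λ) (A : LocalAlg S X) : LocalAlg S Λ :=
  Matrix.of fun σ τ =>
    if ∀ x : {x // x ∈ Λ}, (x : Γ) ∉ X → σ x = τ x then A (restrict h σ) (restrict h τ) else 0

/-- The extension `Φ ⊗ id_{Λ \ Z}` to `𝓐_Λ` of a linear map `Φ` on `𝓐_Z`. -/
def extend {Z Λ : Finset Γ} (h : Z ⊆ Λ) (Φ : LocalAlg S Z →ₗ[ℂ] LocalAlg S Z) :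
    LocalAlg S Λ →ₗ[ℂ] LocalAlg S Λ where
  toFun A := Matrix.of fun σ τ =>
    Φ (Matrix.of fun α β => A (glue α σ) (glue β τ)) (restrict h σ) (restrict h τ)
  map_add' A B := by
    ext σ τ
    exact congrFun (congrFun (Φ.map_add (Matrix.of fun α β => A (glue α σ) (glue β τ))
      (Matrix.of fun α β => B (glue α σ) (glue β τ))) (restrict h σ)) (restrict h τ)
  map_smul' c A := by
    ext σ τ
    exact congrFun (congrFun (Φ.map_smul c (Matrix.of fun α β => A (glue α σ) (glue β τ)))
      (restrict h σ)) (restrict h τ)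

end Spin

section Interaction

variable {Γ : Type*} [DecidableEq Γ] (S : Γ → Type*)
  [∀ x, Fintype (S x)] [∀ x, DecidableEq (S x)]

/-- A dissipative interaction: a map `L_Z : 𝓐_Z → 𝓐_Z` in Lindblad form for each finite `Z`. -/
structure Interaction where
  L : (Z : Finset Γ) → LocalAlg S Z →ₗ[ℂ] LocalAlg S Z
  lindblad : ∀ Z, IsLindblad (L Z)

variable {S}

/-- `M` satisfies `∑_{Z ∋ x,y} ‖L_Z‖_cb ≤ M F(d(x,y))` for all `x, y`. -/
def IsFBound [MetricSpace Γ] (𝓛 : Interaction S) (F : ℝ → ℝ) (M : ℝ) : Prop :=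
  ∀ x y : Γ, (Summable fun Z : {Z : Finset Γ // x ∈ Z ∧ y ∈ Z} => cbNorm (𝓛.L Z)) ∧
    ∑' Z : {Z : Finset Γ // x ∈ Z ∧ y ∈ Z}, cbNorm (𝓛.L Z) ≤ M * F (dist x y)

/-- `‖𝓛‖_F < ∞`. -/
def HasFiniteFNorm [MetricSpace Γ] (𝓛 : Interaction S) (F : ℝ → ℝ) : Prop :=
  ∃ M, IsFBound 𝓛 F M

/-- The `F`-norm `‖𝓛‖_F`. -/
def FNorm [MetricSpace Γ] (𝓛 : Interaction S) (F : ℝ → ℝ) : ℝ := sInf {M | IsFBound 𝓛 F M}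

/-- The finite-volume generator `𝓛^Λ = ∑_{Z ⊆ Λ} L_Z`. -/
def generator (𝓛 : Interaction S) (Λ : Finset Γ) : LocalAlg S Λ →ₗ[ℂ] LocalAlg S Λ :=
  ∑ Z : {Z // Z ∈ Λ.powerset}, extend (Finset.mem_powerset.1 Z.2) (𝓛.L Z)

/-- The local dynamics `T_t^Λ = exp (t 𝓛^Λ)`. -/
def dynamics (𝓛 : Interaction S) (Λ : Finset Γ) (t : ℝ) : LocalAlg S Λ →L[ℂ] LocalAlg S Λ :=
  NormedSpace.exp ((t : ℂ) • LinearMap.toContinuousLinearMap (generator 𝓛 Λ))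

/-- `π` is a local dynamical fixed-point of `𝓛` in `Λ` with convergence governed by
`g : [0,∞) → [0,2]` (the values of `g` at negative arguments are irrelevant). -/
structure IsLocalDynamicalFixedPoint (𝓛 : Interaction S) (Λ : Finset Γ)
    (π : LocalAlg S Λ →ₗ[ℂ] ℂ) (g : ℝ → ℝ) : Prop where
  isState : IsState π
  invariant : ∀ t, 0 ≤ t → ∀ A, π (dynamics 𝓛 Λ t A) = π A
  range : ∀ t, 0 ≤ t → g t ∈ Set.Icc (0 : ℝ) 2
  convergence : ∀ ω : LocalAlg S Λ →ₗ[ℂ] ℂ, IsState ω → ∀ A t, 0 ≤ t →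
    ‖π (dynamics 𝓛 Λ t A) - ω (dynamics 𝓛 Λ t A)‖ ≤ g t * ‖A‖

end Interaction

end OpenSpin

end

/-!
Let `U` and `V` be the neighbourhoods of radius `d(X,Y)/2` of `X` and `Y` in `Λ`; they are disjoint.
Keep only the interaction terms inside `U` or inside `V`. In a product state, the time-evolved
observables of this decoupled dynamics have no covariance. Every dropped term contains, for each
site of `X ∪ Y`, a point at distance at least `d(X,Y)/2` from it, so by a Lieb–Robinson bound the
decoupled evolution of `A`, `B` and `AB` is exponentially close to the true one. Finally,
convergence to the fixed point replaces `π` by a product state evolved up to time `t`, once for each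
of `π(AB)`, `π(A)` and `π(B)`, whence `3 g(t)`.
-/

noncomputable section

namespace OpenSpin

/-! ### Dissipative evolution equations -/

section Dissipative

open Filter Topology Set

/-- Dissipativity of a vector field on a normed space, in the resolvent form
`‖x‖ ≤ ‖(1 - hD) x‖`: the implicit Euler scheme of `y' = D y` is contractive. -/
def IsDissipative {V : Type*} [NormedAddCommGroup V] [NormedSpace ℝ V] (D : V → V) : Prop :=
  ∀ x, ∀ h : ℝ, 0 ≤ h → ‖x‖ ≤ ‖x - h • D x‖

section Real

variable {V : Type*} [NormedAddCommGroup V] [NormedSpace ℝ V] {D : V → V}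

theorem IsDissipative.eventually_norm_lt (hD : IsDissipative D) {y : ℝ → V} {ρ : V} {u r : ℝ}
    (hy : HasDerivAt y (D (y u) + ρ) u) (hr : ‖ρ‖ < r) :
    ∀ᶠ z in 𝓝[<] u, ‖y u‖ < ‖y z‖ + (u - z) * r := by
  have hlin := (hasDerivAt_iff_isLittleO.1 hy).def (half_pos (sub_pos.2 hr))
  filter_upwards [hlin.filter_mono nhdsWithin_le_nhds, self_mem_nhdsWithin] with z hz hzu
  have hh : 0 < u - z := sub_pos.2 hzu
  rw [← neg_sub u z, norm_neg, Real.norm_of_nonneg hh.le] at hz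
  have hEuler : ‖(y u - (u - z) • D (y u)) - y z‖ ≤ (r - ‖ρ‖) / 2 * (u - z) + (u - z) * ‖ρ‖ :=
    calc ‖(y u - (u - z) • D (y u)) - y z‖
        = ‖(y z - y u - (-(u - z)) • (D (y u) + ρ)) - (u - z) • ρ‖ := by
          rw [← norm_neg, smul_add, neg_smul, neg_smul]; congr 1; abel
      _ ≤ _ := (norm_sub_le _ _).trans
          (add_le_add hz (by rw [norm_smul, Real.norm_of_nonneg hh.le]))
  have hcontr := hD (y u) (u - z) hh.le
  have htri := norm_sub_norm_le (y u - (u - z) • D (y u)) (y z)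
  nlinarith [mul_pos (sub_pos.2 hr) hh]

theorem IsDissipative.norm_le_add_sub (hD : IsDissipative D) {y ρ : ℝ → V} {P P' : ℝ → ℝ} {t : ℝ}
    (ht : 0 ≤ t) (hy : ∀ s, HasDerivAt y (D (y s) + ρ s) s) (hP : ∀ s, HasDerivAt P (P' s) s)
    (hρ : ∀ s, 0 ≤ s → ‖ρ s‖ ≤ P' s) :
    ‖y t‖ ≤ ‖y 0‖ + (P t - P 0) := by
  have hyc : Continuous y := continuous_iff_continuousAt.2 fun s => (hy s).continuousAt
  have hPc : Continuous P := continuous_iff_continuousAt.2 fun s => (hP s).continuousAt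
  -- Dissipativity controls backward differences, so the mean value inequality is applied to the
  -- time-reversed function.
  have key := image_le_of_liminf_slope_right_le_deriv_boundary
    (f := fun s => -‖y (t - s)‖) (a := 0) (b := t)
    (B := fun s => -‖y t‖ + (P t - P (t - s))) (B' := fun s => P' (t - s))
    (by fun_prop) (by simp) (by fun_prop)
    (fun s _ => by
      have hsub : HasDerivAt (fun s : ℝ => t - s) (-1) s := by
        simpa using (hasDerivAt_id s).const_sub t
      have := (((hP (t - s)).comp s hsub).const_sub (P t)).const_add (-‖y t‖)
      simpa using! this.hasDerivWithinAt) ?_ (right_mem_Icc.2 ht)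
  · simp only [sub_self] at key
    linarith
  intro s hs r hr
  have hreverse : Tendsto (fun z : ℝ => t - z) (𝓝[>] s) (𝓝[<] (t - s)) :=
    tendsto_nhdsWithin_of_tendsto_nhds_of_eventually_within _
      (((continuous_const.sub continuous_id).tendsto s).mono_left nhdsWithin_le_nhds)
      (by filter_upwards [self_mem_nhdsWithin] with z hz using sub_lt_sub_left hz t)
  have hsource : ‖ρ (t - s)‖ < r := (hρ _ (sub_nonneg.2 hs.2.le)).trans_lt hr
  refine Eventually.frequently ?_
  filter_upwards [hreverse.eventually (hD.eventually_norm_lt (hy (t - s)) hsource),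
    self_mem_nhdsWithin] with z hz hsz
  rw [slope_def_field, div_lt_iff₀ (sub_pos.2 hsz)]
  linarith

end Real

variable {V : Type*} [NormedAddCommGroup V] [NormedSpace ℂ V]

/-- The one-parameter group `t ↦ exp (t D)` generated by a bounded operator. -/
def semigroup (D : V →L[ℂ] V) (t : ℝ) : V →L[ℂ] V := NormedSpace.exp ((t : ℂ) • D)

@[simp] theorem semigroup_zero (D : V →L[ℂ] V) : semigroup D 0 = 1 := by
  simp [semigroup]

variable [CompleteSpace V]

theorem hasDerivAt_semigroup (D : V →L[ℂ] V) (x : V) (t : ℝ) :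
    HasDerivAt (fun s => semigroup D s x) (D (semigroup D t x)) t := by
  have h := hasDerivAt_exp_smul_const' (𝕂 := ℝ) D t
  simp only [← Complex.coe_smul] at h
  exact ((ContinuousLinearMap.apply ℂ V x).restrictScalars ℝ).hasFDerivAt.comp_hasDerivAt t h

theorem norm_semigroup_le {D : V →L[ℂ] V} (hD : IsDissipative D) {t : ℝ} (ht : 0 ≤ t) (x : V) :
    ‖semigroup D t x‖ ≤ ‖x‖ := by
  have hderiv (s : ℝ) : HasDerivAt (fun s => semigroup D s x) (D (semigroup D s x) + 0) s := by
    simpa only [add_zero] using hasDerivAt_semigroup D x s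
  simpa using hD.norm_le_add_sub ht hderiv (fun s => hasDerivAt_const s 0)
    (fun s _ => norm_zero.le)

theorem norm_semigroup_sub_semigroup_le {D D' : V →L[ℂ] V} (hD : IsDissipative D) (x : V)
    {P P' : ℝ → ℝ} {t : ℝ} (ht : 0 ≤ t) (hP : ∀ s, HasDerivAt P (P' s) s)
    (hρ : ∀ s, 0 ≤ s → ‖D (semigroup D' s x) - D' (semigroup D' s x)‖ ≤ P' s) :
    ‖semigroup D t x - semigroup D' t x‖ ≤ P t - P 0 := by
  have hderiv (s : ℝ) : HasDerivAt (fun s => semigroup D s x - semigroup D' s x)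
      (D (semigroup D s x - semigroup D' s x) +
        (D (semigroup D' s x) - D' (semigroup D' s x))) s := by
    simpa only [map_sub, sub_add_sub_cancel] using!
      (hasDerivAt_semigroup D x s).sub (hasDerivAt_semigroup D' x s)
  simpa using hD.norm_le_add_sub ht hderiv hP hρ

theorem norm_apply_semigroup_add_le {K D₁ D₂ : V →L[ℂ] V} (hD₁ : IsDissipative D₁)
    (hcomm : ∀ x, K (D₁ x) = D₁ (K x)) (x : V) {P P' : ℝ → ℝ} {t : ℝ} (ht : 0 ≤ t)
    (hP : ∀ s, HasDerivAt P (P' s) s)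
    (hρ : ∀ s, 0 ≤ s → ‖K (D₂ (semigroup (D₁ + D₂) s x))‖ ≤ P' s) :
    ‖K (semigroup (D₁ + D₂) t x)‖ ≤ ‖K x‖ + (P t - P 0) := by
  have hderiv (s : ℝ) : HasDerivAt (fun s => K (semigroup (D₁ + D₂) s x))
      (D₁ (K (semigroup (D₁ + D₂) s x)) + K (D₂ (semigroup (D₁ + D₂) s x))) s := by
    simpa [hcomm] using! (K.restrictScalars ℝ).hasFDerivAt.comp_hasDerivAt s
      (hasDerivAt_semigroup (D₁ + D₂) x s)
  simpa using hD₁.norm_le_add_sub ht hderiv hP hρ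

theorem semigroup_mem {D : V →L[ℂ] V} {M : Submodule ℂ V} (hM : IsClosed (M : Set V))
    (hDM : ∀ x ∈ M, D x ∈ M) {x : V} (hx : x ∈ M) (t : ℝ) : semigroup D t x ∈ M := by
  have hseries := (NormedSpace.exp_series_hasSum_exp' (𝕂 := ℂ) ((t : ℂ) • D)).mapL
    (ContinuousLinearMap.apply ℂ V x)
  have hpow (n : ℕ) : (((t : ℂ) • D) ^ n) x ∈ M := by
    induction n with
    | zero => simpa using hx
    | succ n ih =>
      rw [pow_succ']
      exact M.smul_mem _ (hDM _ ih)
  exact hM.mem_of_tendsto hseries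
    (Eventually.of_forall fun s => M.sum_mem fun n _ => M.smul_mem _ (hpow n))

theorem semigroup_mul {R : Type*} [NormedRing R] [NormedAlgebra ℂ R] [CompleteSpace R]
    {D : R →L[ℂ] R} {M N : Submodule ℂ R} (hM : IsClosed (M : Set R)) (hN : IsClosed (N : Set R))
    (hDM : ∀ x ∈ M, D x ∈ M) (hDN : ∀ x ∈ N, D x ∈ N)
    (hmul : ∀ p ∈ M, ∀ q ∈ N, D (p * q) = D p * q + p * D q) {p q : R} (hp : p ∈ M) (hq : q ∈ N)
    (t : ℝ) : semigroup D t (p * q) = semigroup D t p * semigroup D t q := by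
  have hderiv (s : ℝ) : HasDerivAt (fun s => semigroup D s p * semigroup D s q)
      (D (semigroup D s p * semigroup D s q)) s := by
    rw [hmul _ (semigroup_mem hM hDM hp s) _ (semigroup_mem hN hDN hq s)]
    exact (hasDerivAt_semigroup D p s).mul (hasDerivAt_semigroup D q s)
  exact congrFun (ODE_solution_unique_univ (v := fun _ => D) (s := fun _ => univ) (t₀ := 0)
    (fun _ => D.lipschitz.lipschitzOnWith)
    (fun s => ⟨hasDerivAt_semigroup D (p * q) s, mem_univ _⟩) (fun s => ⟨hderiv s, mem_univ _⟩)
    (by simp)) t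

end Dissipative

/-! ### Lindblad forms -/

section LindbladForm

/-- The Lindblad form with Hamiltonian `H` and jump operators `K`, in an arbitrary complex star
algebra. -/
def lindbladForm {R ι : Type*} [Ring R] [StarRing R] [Algebra ℂ R] [Fintype ι] (H : R) (K : ι → R)
    (A : R) : R :=
  Complex.I • (H * A - A * H) +
    ∑ j, (star (K j) * A * K j - (1 / 2 : ℂ) • (star (K j) * K j * A + A * (star (K j) * K j)))

/-- `φ` turns left and right multiplication by `a` into left and right multiplication by `b`. -/
structure Intertwines {R S : Type*} [Ring R] [Algebra ℂ R] [Ring S] [Algebra ℂ S]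
    (φ : R →ₗ[ℂ] S) (a : R) (b : S) : Prop where
  left : ∀ x, φ (a * x) = b * φ x
  right : ∀ x, φ (x * a) = φ x * b

variable {R S ι : Type*} [Ring R] [StarRing R] [Algebra ℂ R] [Ring S] [StarRing S] [Algebra ℂ S]
  [Fintype ι]

theorem map_lindbladForm {φ : R →ₗ[ℂ] S} {H : R} {H' : S} {K : ι → R} {K' : ι → S}
    (hH : Intertwines φ H H') (hK : ∀ j, Intertwines φ (K j) (K' j))
    (hK' : ∀ j, Intertwines φ (star (K j)) (star (K' j))) (A : R) :
    φ (lindbladForm H K A) = lindbladForm H' K' (φ A) := by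
  simp only [lindbladForm, map_add, map_sub, map_smul, map_sum, hH.left, hH.right]
  congr! 5 with j
  · rw [mul_assoc, (hK' j).left, (hK j).right, mul_assoc]
  · rw [mul_assoc, (hK' j).left, (hK j).left, mul_assoc]
  · rw [← mul_assoc, (hK j).right, (hK' j).right, mul_assoc]

theorem starHom_lindbladForm {F : Type*} [FunLike F R S] [AlgHomClass F ℂ R S] [StarHomClass F R S]
    (f : F) (H : R) (K : ι → R) (A : R) :
    f (lindbladForm H K A) = lindbladForm (f H) (fun j => f (K j)) (f A) := by
  have hf (a : R) : Intertwines (f : R →ₗ[ℂ] S) a (f a) := ⟨map_mul f a, fun x => map_mul f x a⟩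
  exact map_lindbladForm (hf H) (fun j => hf (K j))
    (fun j => by simpa only [map_star] using hf (star (K j))) A

@[simp] theorem lindbladForm_one (H : R) (K : ι → R) : lindbladForm H K 1 = 0 := by
  have hhalf (x : R) : x - (1 / 2 : ℂ) • (x + x) = 0 := by
    rw [← two_smul ℂ x, smul_smul]; norm_num
  simp only [lindbladForm, mul_one, one_mul, sub_self, smul_zero, hhalf, Finset.sum_const_zero,
    add_zero]

theorem norm_lindbladForm_le {R : Type*} [NormedRing R] [StarRing R] [NormedStarGroup R]
    [NormedAlgebra ℂ R] (H : R) (K : ι → R) (A : R) :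
    ‖lindbladForm H K A‖ ≤ (2 * ‖H‖ + ∑ j, 2 * ‖K j‖ ^ 2) * ‖A‖ := by
  rw [add_mul, Finset.sum_mul]
  refine (norm_add_le _ _).trans (add_le_add ?_ ((norm_sum_le _ _).trans
    (Finset.sum_le_sum fun j _ => ?_)))
  · rw [norm_smul, Complex.norm_I, one_mul]
    linarith [norm_sub_le (H * A) (A * H), norm_mul_le H A, norm_mul_le A H, mul_comm ‖A‖ ‖H‖]
  · have hsq : ‖star (K j) * K j‖ ≤ ‖K j‖ ^ 2 := by
      simpa only [norm_star, sq] using norm_mul_le (star (K j)) (K j)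
    have hsandwich : ‖star (K j) * A * K j‖ ≤ ‖K j‖ ^ 2 * ‖A‖ := by
      simpa only [norm_star, sq, mul_right_comm] using norm_mul₃_le (a := star (K j))
    have hleft : ‖star (K j) * K j * A‖ ≤ ‖K j‖ ^ 2 * ‖A‖ :=
      norm_mul_le_of_le hsq le_rfl
    have hright : ‖A * (star (K j) * K j)‖ ≤ ‖K j‖ ^ 2 * ‖A‖ := by
      simpa only [mul_comm] using norm_mul_le_of_le (le_refl ‖A‖) hsq
    refine (norm_sub_le _ _).trans ?_
    rw [norm_smul, show ‖(1 / 2 : ℂ)‖ = 1 / 2 by norm_num]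
    linarith [norm_add_le (star (K j) * K j * A) (A * (star (K j) * K j))]

end LindbladForm

/-! ### Lindblad generators are dissipative -/

section NormingVectors

open scoped InnerProductSpace

variable {E F : Type*} [NormedAddCommGroup E] [InnerProductSpace ℂ E]
  [NormedAddCommGroup F] [InnerProductSpace ℂ F]

theorem exists_norm_apply_eq_opNorm [FiniteDimensional ℂ E] [Nontrivial E] (T : E →L[ℂ] F) :
    ∃ ξ, ‖ξ‖ = 1 ∧ ‖T ξ‖ = ‖T‖ := by
  have := FiniteDimensional.proper ℂ E
  obtain ⟨ξ, hξ, hmax⟩ := (isCompact_sphere (0 : E) 1).exists_isMaxOn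
    (NormedSpace.sphere_nonempty.2 zero_le_one) (f := fun ξ => ‖T ξ‖) (by fun_prop)
  have hξ : ‖ξ‖ = 1 := by simpa using hξ
  refine ⟨ξ, hξ, (T.unit_le_opNorm ξ hξ.le).antisymm ?_⟩
  exact T.opNorm_le_of_unit_norm (norm_nonneg _) fun x hx => hmax (by simpa using hx)

theorem inner_apply_apply_of_norm_apply_eq [CompleteSpace E] [CompleteSpace F] {T : E →L[ℂ] F}
    {ξ : E} (hξ : ‖ξ‖ = 1) (hT : ‖T ξ‖ = ‖T‖) (x : E) :
    ⟪T ξ, T x⟫_ℂ = (‖T‖ : ℂ) ^ 2 * ⟪ξ, x⟫_ℂ := by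
  set S := ContinuousLinearMap.adjoint T
  have hnorm : ‖S (T ξ)‖ ≤ ‖T‖ ^ 2 := by
    simpa only [S, ContinuousLinearMap.adjoint.norm_map, hT, sq] using S.le_opNorm (T ξ)
  have hinner : RCLike.re ⟪S (T ξ), ((‖T‖ ^ 2 : ℝ) : ℂ) • ξ⟫_ℂ = ‖T‖ ^ 4 := by
    rw [inner_smul_right, ContinuousLinearMap.adjoint_inner_left, inner_self_eq_norm_sq_to_K, hT,
      ← RCLike.ofReal_pow]
    refine (RCLike.re_ofReal_mul (K := ℂ) _ _).trans ?_
    rw [RCLike.ofReal_re]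
    exact (pow_add _ 2 2).symm
  have hsq : ‖S (T ξ) - ((‖T‖ ^ 2 : ℝ) : ℂ) • ξ‖ ^ 2 ≤ 0 := by
    rw [@norm_sub_sq ℂ, hinner, norm_smul, hξ, Complex.norm_of_nonneg (by positivity)]
    nlinarith [pow_le_pow_left₀ (norm_nonneg _) hnorm 2]
  have heigen : S (T ξ) = ((‖T‖ ^ 2 : ℝ) : ℂ) • ξ :=
    sub_eq_zero.1 (norm_eq_zero.1 (pow_eq_zero_iff two_ne_zero |>.1
      (le_antisymm hsq (sq_nonneg _))))
  rw [← ContinuousLinearMap.adjoint_inner_left, heigen, inner_smul_left, Complex.conj_ofReal,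
    Complex.ofReal_pow]

variable [CompleteSpace E] {T : E →L[ℂ] E} {ξ : E}

theorem re_inner_commutator_eq_zero {H : E →L[ℂ] E} (hH : IsSelfAdjoint H) (hξ : ‖ξ‖ = 1)
    (hT : ‖T ξ‖ = ‖T‖) : (⟪T ξ, (Complex.I • (H * T - T * H)) ξ⟫_ℂ).re = 0 := by
  have him (x : E) : (⟪x, H x⟫_ℂ).im = 0 := by
    refine Complex.conj_eq_iff_im.1 ?_
    rw [inner_conj_symm]
    exact hH.isSymmetric x x
  have hTH : ⟪T ξ, T (H ξ)⟫_ℂ = (‖T‖ ^ 2 : ℝ) * ⟪ξ, H ξ⟫_ℂ := by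
    rw [inner_apply_apply_of_norm_apply_eq hξ hT, Complex.ofReal_pow]
  simp [hTH, him, -Complex.ofReal_pow]

theorem re_inner_jump_nonpos (K : E →L[ℂ] E) (hξ : ‖ξ‖ = 1) (hT : ‖T ξ‖ = ‖T‖) :
    (⟪T ξ, (star K * T * K - (1 / 2 : ℂ) • (star K * K * T + T * (star K * K))) ξ⟫_ℂ).re ≤ 0 := by
  have hsandwich : (⟪K (T ξ), T (K ξ)⟫_ℂ).re ≤ ‖K (T ξ)‖ * (‖T‖ * ‖K ξ‖) :=
    (re_inner_le_norm (𝕜 := ℂ) _ _).trans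
      (mul_le_mul_of_nonneg_left (T.le_opNorm _) (norm_nonneg _))
  have hexpand : (⟪T ξ, (star K * T * K -
      (1 / 2 : ℂ) • (star K * K * T + T * (star K * K))) ξ⟫_ℂ).re =
      (⟪K (T ξ), T (K ξ)⟫_ℂ).re - 1 / 2 * (‖K (T ξ)‖ ^ 2 + ‖T‖ ^ 2 * ‖K ξ‖ ^ 2) := by
    rw [← Complex.ofReal_re (1 / 2 * _), ← Complex.sub_re]
    congr 1
    simp [ContinuousLinearMap.star_eq_adjoint, ContinuousLinearMap.adjoint_inner_right,
      inner_apply_apply_of_norm_apply_eq hξ hT, mul_add]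
  rw [hexpand]
  nlinarith [sq_nonneg (‖K (T ξ)‖ - ‖T‖ * ‖K ξ‖)]

theorem re_inner_lindbladForm_nonpos {ι : Type*} [Fintype ι] {H : E →L[ℂ] E}
    (hH : IsSelfAdjoint H) (K : ι → E →L[ℂ] E) (hξ : ‖ξ‖ = 1) (hT : ‖T ξ‖ = ‖T‖) :
    (⟪T ξ, lindbladForm H K T ξ⟫_ℂ).re ≤ 0 := by
  rw [lindbladForm, _root_.add_apply, inner_add_right, Complex.add_re,
    re_inner_commutator_eq_zero hH hξ hT, zero_add, _root_.sum_apply, inner_sum, Complex.re_sum]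
  exact Finset.sum_nonpos fun j _ => re_inner_jump_nonpos (K j) hξ hT

end NormingVectors

section Matrix

open Matrix

variable {n : Type*} [Fintype n] [DecidableEq n]

local notation "𝖳" => Matrix.toEuclideanCLM (n := n) (𝕜 := ℂ)

/-- The flow of `Φ` does not increase the operator norm to first order, tested at the unit vectors
`ξ` at which `A` attains its norm. Unlike dissipativity, this is visibly additive in `Φ`. -/
def IsNormDecreasing (Φ : Matrix n n ℂ →ₗ[ℂ] Matrix n n ℂ) : Prop :=
  ∀ (A : Matrix n n ℂ) (ξ : EuclideanSpace ℂ n), ‖ξ‖ = 1 → ‖𝖳 A ξ‖ = ‖A‖ →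
    (inner ℂ (𝖳 A ξ) (𝖳 (Φ A) ξ)).re ≤ 0

theorem IsNormDecreasing.sum {ι : Type*} (s : Finset ι)
    {Φ : ι → Matrix n n ℂ →ₗ[ℂ] Matrix n n ℂ} (h : ∀ i ∈ s, IsNormDecreasing (Φ i)) :
    IsNormDecreasing (∑ i ∈ s, Φ i) := by
  intro A ξ hξ hA
  rw [LinearMap.sum_apply, map_sum, _root_.sum_apply, inner_sum, Complex.re_sum]
  exact Finset.sum_nonpos fun i hi => h i hi A ξ hξ hA

theorem IsLindblad.isNormDecreasing {Φ : Matrix n n ℂ →ₗ[ℂ] Matrix n n ℂ} (h : IsLindblad Φ) :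
    IsNormDecreasing Φ := by
  obtain ⟨H, hH, ℓ, K, hΦ⟩ := h
  intro A ξ hξ hA
  have hform : 𝖳 (Φ A) = lindbladForm (𝖳 H) (fun j => 𝖳 (K j)) (𝖳 A) := by
    rw [show Φ A = lindbladForm H K A from hΦ A]
    exact starHom_lindbladForm 𝖳 H K A
  rw [hform]
  exact re_inner_lindbladForm_nonpos (IsSelfAdjoint.map hH 𝖳) _ hξ hA

theorem IsNormDecreasing.isDissipative {Φ : Matrix n n ℂ →ₗ[ℂ] Matrix n n ℂ}
    (h : IsNormDecreasing Φ) : IsDissipative Φ := by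
  intro A t ht
  rcases isEmpty_or_nonempty n with hn | hn
  · simp [Subsingleton.elim A 0]
  obtain ⟨ξ, hξ, hA⟩ := exists_norm_apply_eq_opNorm (𝖳 A)
  change ‖𝖳 A ξ‖ = ‖A‖ at hA
  rcases (norm_nonneg A).eq_or_lt with hzero | hpos
  · exact hzero ▸ norm_nonneg _
  refine le_of_mul_le_mul_left ?_ hpos
  calc ‖A‖ * ‖A‖
      ≤ ‖A‖ * ‖A‖ - t * (inner ℂ (𝖳 A ξ) (𝖳 (Φ A) ξ)).re := by
        nlinarith [mul_nonneg ht (neg_nonneg.2 (h A ξ hξ hA))]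
    _ = (inner ℂ (𝖳 A ξ) (𝖳 (A - (t : ℂ) • Φ A) ξ)).re := by
        rw [map_sub, map_smul, _root_.sub_apply, _root_.smul_apply, inner_sub_right,
          inner_smul_right, inner_self_eq_norm_sq_to_K, hA, Complex.sub_re, Complex.re_ofReal_mul,
          ← sq]
        norm_cast
    _ ≤ ‖𝖳 A ξ‖ * ‖𝖳 (A - (t : ℂ) • Φ A) ξ‖ := re_inner_le_norm (𝕜 := ℂ) _ _
    _ ≤ ‖A‖ * ‖A - (t : ℂ) • Φ A‖ := by
        rw [hA]
        gcongr
        exact (𝖳 _).unit_le_opNorm ξ hξ.le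
    _ = ‖A‖ * ‖A - t • Φ A‖ := by rw [Complex.coe_smul]

/-! ### States -/

theorem IsState.nonempty {ω : Matrix n n ℂ →ₗ[ℂ] ℂ} (hω : IsState ω) : Nonempty n := by
  by_contra hn
  have := not_nonempty_iff.1 hn
  simpa [Subsingleton.elim (1 : Matrix n n ℂ) 0] using hω.map_one

theorem IsState.apply_conjTranspose {ω : Matrix n n ℂ →ₗ[ℂ] ℂ} (hω : IsState ω)
    (A : Matrix n n ℂ) : ω Aᴴ = (starRingEnd ℂ) (ω A) := by
  have hreal (B : Matrix n n ℂ) : (ω (Bᴴ * B)).im = 0 := ((Complex.le_def.1 (hω.nonneg B)).2).symm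
  -- Polarization: the squares of `A + 1` and `A + i` give the imaginary and the real parts.
  have hA := hreal A
  have hone := hreal (A + 1)
  have hI := hreal (A + Complex.I • 1)
  simp only [conjTranspose_add, conjTranspose_smul, conjTranspose_one, add_mul, mul_add, mul_one,
    one_mul, map_add, Complex.add_im, smul_mul_assoc, mul_smul_comm, map_smul, smul_eq_mul,
    hω.map_one] at hone hI
  apply Complex.ext <;> simp at hA hone hI ⊢ <;> linarith

open scoped MatrixOrder in
theorem IsState.apply_conjTranspose_mul_self_le {ω : Matrix n n ℂ →ₗ[ℂ] ℂ} (hω : IsState ω)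
    (A : Matrix n n ℂ) : ω (Aᴴ * A) ≤ ((‖A‖ ^ 2 : ℝ) : ℂ) := by
  obtain ⟨B, hB⟩ := CStarAlgebra.nonneg_iff_eq_star_mul_self.1
    (sub_nonneg.2 (CStarAlgebra.star_mul_le_algebraMap_norm_sq (a := A)))
  have hdiff := hω.nonneg B
  rw [← star_eq_conjTranspose, ← hB, map_sub, Algebra.algebraMap_eq_smul_one,
    ← Complex.coe_smul, map_smul, hω.map_one, smul_eq_mul, mul_one] at hdiff
  exact sub_nonneg.1 hdiff

theorem IsState.norm_sq_apply_le {ω : Matrix n n ℂ →ₗ[ℂ] ℂ} (hω : IsState ω) (A : Matrix n n ℂ) :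
    ((‖ω A‖ ^ 2 : ℝ) : ℂ) ≤ ω (Aᴴ * A) := by
  have hvariance : ω ((A - ω A • 1)ᴴ * (A - ω A • 1)) = ω (Aᴴ * A) - ((‖ω A‖ ^ 2 : ℝ) : ℂ) := by
    rw [← Complex.normSq_eq_norm_sq, ← Complex.mul_conj]
    simp only [conjTranspose_sub, conjTranspose_smul, conjTranspose_one, sub_mul, mul_sub, mul_one,
      one_mul, map_sub, smul_mul_assoc, mul_smul_comm, map_smul, smul_eq_mul, hω.map_one,
      hω.apply_conjTranspose, Complex.star_def]
    ring
  exact sub_nonneg.1 (hvariance ▸ hω.nonneg (A - ω A • 1))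

theorem IsState.norm_apply_le {ω : Matrix n n ℂ →ₗ[ℂ] ℂ} (hω : IsState ω) (A : Matrix n n ℂ) :
    ‖ω A‖ ≤ ‖A‖ :=
  le_of_sq_le_sq (Complex.real_le_real.1
    ((hω.norm_sq_apply_le A).trans (hω.apply_conjTranspose_mul_self_le A))) (norm_nonneg _)

/-- The vector state `A ↦ ⟨e_i, A e_i⟩` of a basis vector, a product state when `i` is a spin
configuration. -/
def diagState (i : n) : Matrix n n ℂ →ₗ[ℂ] ℂ := entryLinearMap ℂ ℂ i i

theorem isState_diagState (i : n) : IsState (diagState i) where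
  nonneg A := (posSemidef_conjTranspose_mul_self A).diag_nonneg
  map_one := one_apply_eq i

end Matrix

/-! ### Tensor extensions of maps -/

section Tensor

open Matrix Kronecker

variable {κ σ τ : Type*}

/-- The block, indexed by a pair `p, q` of indices of the second tensor factor, of a matrix over
`κ ≃ σ × τ`. -/
def slice (e : κ ≃ σ × τ) (p q : τ) : Matrix κ κ ℂ →ₗ[ℂ] Matrix σ σ ℂ where
  toFun M := Matrix.of fun i j => M (e.symm (i, p)) (e.symm (j, q))
  map_add' _ _ := rfl
  map_smul' _ _ := rfl

@[simp] theorem slice_apply (e : κ ≃ σ × τ) (p q : τ) (M : Matrix κ κ ℂ) (i j : σ) :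
    slice e p q M i j = M (e.symm (i, p)) (e.symm (j, q)) := rfl

theorem slice_apply_self (e : κ ≃ σ × τ) (M : Matrix κ κ ℂ) (k l : κ) :
    slice e (e k).2 (e l).2 M (e k).1 (e l).1 = M k l := by
  simp

/-- `Φ ⊗ id`, transported along `e : κ ≃ σ × τ`. -/
def tensorExt (e : κ ≃ σ × τ) (Φ : Matrix σ σ ℂ →ₗ[ℂ] Matrix σ σ ℂ) (M : Matrix κ κ ℂ) :
    Matrix κ κ ℂ :=
  Matrix.of fun k l => Φ (slice e (e k).2 (e l).2 M) (e k).1 (e l).1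

theorem ampliation_apply_eq_tensorExt (Φ : Matrix σ σ ℂ →ₗ[ℂ] Matrix σ σ ℂ) (n : ℕ)
    (M : Matrix (σ × Fin n) (σ × Fin n) ℂ) :
    ampliation Φ n M = tensorExt (Equiv.refl (σ × Fin n)) Φ M := rfl

variable [Fintype κ] [Fintype σ] [DecidableEq κ] [DecidableEq σ]

/-- `A ↦ A ⊗ 1`, transported along `e : κ ≃ σ × τ`. -/
def tensorHom [Fintype τ] [DecidableEq τ] (e : κ ≃ σ × τ) :
    Matrix σ σ ℂ →⋆ₐ[ℂ] Matrix κ κ ℂ where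
  toFun A := (A ⊗ₖ (1 : Matrix τ τ ℂ)).submatrix e e
  map_one' := by simp
  map_mul' A B := by rw [submatrix_mul_equiv, ← mul_kronecker_mul, one_mul]
  map_zero' := by simp
  map_add' A B := by rw [add_kronecker]; rfl
  commutes' c := by
    rw [Algebra.algebraMap_eq_smul_one, Algebra.algebraMap_eq_smul_one, smul_kronecker,
      one_kronecker_one]
    exact congrArg (fun M : Matrix κ κ ℂ => c • M) (submatrix_one_equiv e)
  map_star' A := by
    simp [star_eq_conjTranspose, conjTranspose_submatrix, conjTranspose_kronecker]

theorem tensorHom_apply [Fintype τ] [DecidableEq τ] (e : κ ≃ σ × τ) (A : Matrix σ σ ℂ) (k l : κ) :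
    tensorHom e A k l = A (e k).1 (e l).1 * (1 : Matrix τ τ ℂ) (e k).2 (e l).2 := rfl

theorem norm_submatrix_equiv_le (e : κ ≃ σ) (A : Matrix σ σ ℂ) : ‖A.submatrix e e‖ ≤ ‖A‖ := by
  have hA : tensorHom (e.trans (Equiv.prodUnique σ Unit).symm) A = A.submatrix e e := by
    ext i j
    simp [tensorHom_apply]
  exact hA ▸ NonUnitalStarAlgHom.norm_apply_le (tensorHom _) A

theorem cbNorm_nonneg (Φ : Matrix σ σ ℂ →ₗ[ℂ] Matrix σ σ ℂ) : 0 ≤ cbNorm Φ :=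
  Real.iSup_nonneg fun _ => norm_nonneg _

section Finite

variable [Fintype τ] [DecidableEq τ] (e : κ ≃ σ × τ)

theorem intertwines_slice_tensorHom (A : Matrix σ σ ℂ) (p q : τ) :
    Intertwines (slice e p q) (tensorHom e A) A where
  left M := by
    ext i j
    simp only [slice_apply, mul_apply, tensorHom_apply]
    rw [← e.symm.sum_comp, Fintype.sum_prod_type]
    simp [one_apply]
  right M := by
    ext i j
    simp only [slice_apply, mul_apply, tensorHom_apply]
    rw [← e.symm.sum_comp, Fintype.sum_prod_type]
    simp [one_apply]

theorem tensorExt_eq_lindbladForm {Φ : Matrix σ σ ℂ →ₗ[ℂ] Matrix σ σ ℂ} {ι : Type*} [Fintype ι]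
    {H : Matrix σ σ ℂ} {K : ι → Matrix σ σ ℂ} (h : ∀ A, Φ A = lindbladForm H K A)
    (M : Matrix κ κ ℂ) :
    tensorExt e Φ M = lindbladForm (tensorHom e H) (fun j => tensorHom e (K j)) M := by
  ext k l
  rw [← slice_apply_self e (lindbladForm _ _ M),
    map_lindbladForm (intertwines_slice_tensorHom e H _ _)
      (fun j => intertwines_slice_tensorHom e (K j) _ _)
      (fun j => by simpa only [map_star] using intertwines_slice_tensorHom e (star (K j)) _ _), ← h]
  rfl

end Finite

theorem IsLindblad.bddAbove {Φ : Matrix σ σ ℂ →ₗ[ℂ] Matrix σ σ ℂ} (h : IsLindblad Φ) :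
    BddAbove (Set.range fun n : ℕ => ‖LinearMap.toContinuousLinearMap (ampliation Φ n)‖) := by
  obtain ⟨H, -, ℓ, K, hΦ⟩ := h
  refine ⟨2 * ‖H‖ + ∑ j, 2 * ‖K j‖ ^ 2, ?_⟩
  rintro _ ⟨n, rfl⟩
  refine ContinuousLinearMap.opNorm_le_bound _ (by positivity) fun M => ?_
  rw [LinearMap.coe_toContinuousLinearMap', ampliation_apply_eq_tensorExt,
    tensorExt_eq_lindbladForm _ hΦ]
  refine (norm_lindbladForm_le _ _ _).trans ?_
  gcongr <;> exact NonUnitalStarAlgHom.norm_apply_le (tensorHom _) _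

theorem norm_tensorExt_le [Finite τ] (e : κ ≃ σ × τ) {Φ : Matrix σ σ ℂ →ₗ[ℂ] Matrix σ σ ℂ}
    (h : IsLindblad Φ) (M : Matrix κ κ ℂ) : ‖tensorExt e Φ M‖ ≤ cbNorm Φ * ‖M‖ := by
  obtain ⟨n, ⟨f⟩⟩ := Finite.exists_equiv_fin τ
  let e' : κ ≃ σ × Fin n := e.trans ((Equiv.refl σ).prodCongr f)
  have hreindex : tensorExt e Φ M =
      (ampliation Φ n (M.submatrix e'.symm e'.symm)).submatrix e' e' := by
    ext k l
    have hslice : slice e (e k).2 (e l).2 M = Matrix.of fun i j =>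
        (M.submatrix e'.symm e'.symm) (i, (e' k).2) (j, (e' l).2) := by
      ext i j
      simp [e']
    exact congrFun (congrFun (congrArg Φ hslice) _) _
  calc ‖tensorExt e Φ M‖ ≤ ‖ampliation Φ n (M.submatrix e'.symm e'.symm)‖ := by
        rw [hreindex]; exact norm_submatrix_equiv_le _ _
    _ ≤ ‖LinearMap.toContinuousLinearMap (ampliation Φ n)‖ * ‖M.submatrix e'.symm e'.symm‖ :=
        (LinearMap.toContinuousLinearMap (ampliation Φ n)).le_opNorm _
    _ ≤ cbNorm Φ * ‖M‖ := mul_le_mul (le_ciSup h.bddAbove n) (norm_submatrix_equiv_le _ _)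
        (norm_nonneg _) (cbNorm_nonneg Φ)

end Tensor

/-! ### Local algebras and local generators -/

section Local

open Matrix

variable {Γ : Type*} {S : Γ → Type*} {X Y Z Λ : Finset Γ}

@[simp] theorem restrict_apply (h : X ⊆ Λ) (σ : Config S Λ) (x : {x // x ∈ X}) :
    restrict h σ x = σ ⟨x, h x.2⟩ := rfl

section Glue

variable [DecidableEq Γ]

/-- The splitting of configurations of `Λ` into configurations of `X` and of `Λ \ X`. -/
def configEquiv (h : X ⊆ Λ) :
    Config S Λ ≃ Config S X × ((x : {x : {x // x ∈ Λ} // (x : Γ) ∉ X}) → S x) where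
  toFun σ := (restrict h σ, fun x => σ x)
  invFun p := fun x => if hx : (x : Γ) ∈ X then p.1 ⟨x, hx⟩ else p.2 ⟨x, hx⟩
  left_inv σ := by
    ext x
    by_cases hx : (x : Γ) ∈ X <;> simp [hx]
  right_inv p := by
    ext x
    · simp
    · simp [x.2]

theorem glue_eq_configEquiv_symm (h : X ⊆ Λ) (α : Config S X) (σ : Config S Λ) :
    glue α σ = (configEquiv h).symm (α, (configEquiv h σ).2) := by
  ext x
  by_cases hx : (x : Γ) ∈ X <;> simp [glue, configEquiv, hx]

theorem extend_apply_eq_tensorExt (h : Z ⊆ Λ) (Φ : LocalAlg S Z →ₗ[ℂ] LocalAlg S Z)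
    (M : LocalAlg S Λ) : extend h Φ M = tensorExt (configEquiv h) Φ M := by
  ext σ τ
  simp only [extend, glue_eq_configEquiv_symm h]
  rfl

end Glue

theorem embed_apply_of_agree (h : X ⊆ Λ) (A : LocalAlg S X) {σ τ : Config S Λ}
    (hστ : ∀ x : {x // x ∈ Λ}, (x : Γ) ∉ X → σ x = τ x) :
    embed h A σ τ = A (restrict h σ) (restrict h τ) :=
  if_pos hστ

theorem embed_apply_eq_zero (h : X ⊆ Λ) (A : LocalAlg S X) {σ τ : Config S Λ}
    {x : {x // x ∈ Λ}} (hx : (x : Γ) ∉ X) (hστ : σ x ≠ τ x) : embed h A σ τ = 0 :=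
  if_neg fun hagree => hστ (hagree x hx)

theorem embed_embed (h : X ⊆ Y) (h' : Y ⊆ Λ) (A : LocalAlg S X) :
    embed h' (embed h A) = embed (h.trans h') A := by
  ext σ τ
  by_cases hY : ∀ x : {x // x ∈ Λ}, (x : Γ) ∉ Y → σ x = τ x
  · rw [embed_apply_of_agree h' _ hY]
    by_cases hX : ∀ x : {x // x ∈ Λ}, (x : Γ) ∉ X → σ x = τ x
    · rw [embed_apply_of_agree _ _ hX, embed_apply_of_agree _ _ fun x => hX ⟨x, h' x.2⟩]
      rfl
    · push Not at hX
      obtain ⟨x, hx, hne⟩ := hX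
      have hxY : (x : Γ) ∈ Y := by_contra fun hxY => hne (hY x hxY)
      rw [embed_apply_eq_zero _ _ hx hne]
      exact embed_apply_eq_zero h A (x := ⟨x, hxY⟩) hx hne
  · push Not at hY
    obtain ⟨x, hx, hne⟩ := hY
    rw [embed_apply_eq_zero h' _ hx hne, embed_apply_eq_zero _ _ (fun hxX => hx (h hxX)) hne]

theorem embed_mul_embed_apply [DecidableEq Γ] [∀ x, Fintype (S x)] (hX : X ⊆ Λ) (hY : Y ⊆ Λ)
    (hd : Disjoint X Y) (A : LocalAlg S X) (B : LocalAlg S Y) (σ τ : Config S Λ)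
    [Decidable (∀ x : {x // x ∈ Λ}, (x : Γ) ∉ X → (x : Γ) ∉ Y → σ x = τ x)] :
    (embed hX A * embed hY B) σ τ =
      if ∀ x : {x // x ∈ Λ}, (x : Γ) ∉ X → (x : Γ) ∉ Y → σ x = τ x then
        A (restrict hX σ) (restrict hX τ) * B (restrict hY σ) (restrict hY τ) else 0 := by
  -- The only intermediate configuration that contributes is `τ` on `X` and `σ` off `X`.
  let ρ : Config S Λ := glue (restrict hX τ) σ
  have hin (x : {x // x ∈ Λ}) (hx : (x : Γ) ∈ X) : ρ x = τ x := by simp [ρ, glue, hx]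
  have hout (x : {x // x ∈ Λ}) (hx : (x : Γ) ∉ X) : ρ x = σ x := by simp [ρ, glue, hx]
  have hsingle : (embed hX A * embed hY B) σ τ = embed hX A σ ρ * embed hY B ρ τ := by
    rw [mul_apply]
    refine Fintype.sum_eq_single ρ fun ρ' hne => ?_
    obtain ⟨x, hx⟩ := Function.ne_iff.1 hne
    by_cases hxX : (x : Γ) ∈ X
    · rw [embed_apply_eq_zero hY B (Finset.disjoint_left.1 hd hxX) (hin x hxX ▸ hx), mul_zero]
    · rw [embed_apply_eq_zero hX A hxX (hout x hxX ▸ hx.symm), zero_mul]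
  rw [hsingle, embed_apply_of_agree hX A fun x hx => (hout x hx).symm,
    show restrict hX ρ = restrict hX τ from funext fun x => hin _ x.2]
  split_ifs with hστ
  · have hρτ (x : {x // x ∈ Λ}) (hx : (x : Γ) ∉ Y) : ρ x = τ x := by
      by_cases hxX : (x : Γ) ∈ X
      · exact hin x hxX
      · rw [hout x hxX, hστ x hxX hx]
    rw [embed_apply_of_agree hY B hρτ, show restrict hY ρ = restrict hY σ from
      funext fun x => hout _ (Finset.disjoint_right.1 hd x.2)]
  · push Not at hστ
    obtain ⟨x, hxX, hxY, hne⟩ := hστ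
    rw [embed_apply_eq_zero hY B hxY (hout x hxX ▸ hne), mul_zero]

variable [DecidableEq Γ] [∀ x, Fintype (S x)] [∀ x, DecidableEq (S x)]

/-- The inclusion `𝓐_X ⊆ 𝓐_Λ` as a homomorphism of star algebras. -/
def embedHom (h : X ⊆ Λ) : LocalAlg S X →⋆ₐ[ℂ] LocalAlg S Λ := tensorHom (configEquiv h)

theorem embedHom_apply (h : X ⊆ Λ) (A : LocalAlg S X) : embedHom h A = embed h A := by
  ext σ τ
  have hagree : (∀ x : {x // x ∈ Λ}, (x : Γ) ∉ X → σ x = τ x) ↔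
      (configEquiv h σ).2 = (configEquiv h τ).2 :=
    ⟨fun H => funext fun x => H x.1 x.2, fun H x hx => congrFun H ⟨x, hx⟩⟩
  rw [embedHom, tensorHom_apply, one_apply]
  simp only [embed, of_apply, hagree, mul_ite, mul_one, mul_zero]
  rfl

theorem norm_embed_le (h : X ⊆ Λ) (A : LocalAlg S X) : ‖embed h A‖ ≤ ‖A‖ :=
  embedHom_apply h A ▸ NonUnitalStarAlgHom.norm_apply_le (embedHom h) A

/-- The algebra of operators of `𝓐_Λ` supported in `X`. -/
def supported (S : Γ → Type*) [∀ x, Fintype (S x)] [∀ x, DecidableEq (S x)] (h : X ⊆ Λ) :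
    StarSubalgebra ℂ (LocalAlg S Λ) :=
  (embedHom (S := S) h).range

theorem mem_supported {h : X ⊆ Λ} {M : LocalAlg S Λ} :
    M ∈ supported S h ↔ ∃ A, embed h A = M := by
  simp only [← embedHom_apply]
  exact Iff.rfl

theorem supported_mono (h : X ⊆ Y) (hX : X ⊆ Λ) (hY : Y ⊆ Λ) :
    supported S hX ≤ supported S hY := fun M hM => by
  obtain ⟨A, rfl⟩ := mem_supported.1 hM
  exact mem_supported.2 ⟨embed h A, embed_embed h hY A⟩

theorem isClosed_supported (h : X ⊆ Λ) : IsClosed (supported S h : Set (LocalAlg S Λ)) :=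
  Submodule.closed_of_finiteDimensional (Subalgebra.toSubmodule (supported S h).toSubalgebra)

theorem commute_of_mem_supported {hX : X ⊆ Λ} {hY : Y ⊆ Λ} (hd : Disjoint X Y)
    {M N : LocalAlg S Λ} (hM : M ∈ supported S hX) (hN : N ∈ supported S hY) : Commute M N := by
  classical
  obtain ⟨A, rfl⟩ := mem_supported.1 hM
  obtain ⟨B, rfl⟩ := mem_supported.1 hN
  ext σ τ
  rw [embed_mul_embed_apply hX hY hd, embed_mul_embed_apply hY hX hd.symm, mul_comm (B _ _)]
  exact if_congr (forall_congr' fun x => forall_comm) rfl rfl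

theorem diagState_mul {hX : X ⊆ Λ} {hY : Y ⊆ Λ} (hd : Disjoint X Y) (σ : Config S Λ)
    {M N : LocalAlg S Λ} (hM : M ∈ supported S hX) (hN : N ∈ supported S hY) :
    diagState σ (M * N) = diagState σ M * diagState σ N := by
  classical
  obtain ⟨A, rfl⟩ := mem_supported.1 hM
  obtain ⟨B, rfl⟩ := mem_supported.1 hN
  change (embed hX A * embed hY B) σ σ = embed hX A σ σ * embed hY B σ σ
  rw [embed_mul_embed_apply hX hY hd, if_pos fun _ _ _ => rfl,
    embed_apply_of_agree hX A fun _ _ => rfl, embed_apply_of_agree hY B fun _ _ => rfl]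

variable (𝓛 : Interaction S)

theorem exists_extend_eq_lindbladForm (h : Z ⊆ Λ) :
    ∃ H : LocalAlg S Z, H.IsHermitian ∧ ∃ (ℓ : ℕ) (K : Fin ℓ → LocalAlg S Z),
      ∀ M, extend h (𝓛.L Z) M = lindbladForm (embedHom h H) (fun j => embedHom h (K j)) M := by
  obtain ⟨H, hH, ℓ, K, hΦ⟩ := 𝓛.lindblad Z
  refine ⟨H, hH, ℓ, K, fun M => ?_⟩
  rw [extend_apply_eq_tensorExt]
  exact tensorExt_eq_lindbladForm _ hΦ M

theorem isLindblad_extend (h : Z ⊆ Λ) : IsLindblad (extend h (𝓛.L Z)) := by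
  obtain ⟨H, hH, ℓ, K, hΦ⟩ := exists_extend_eq_lindbladForm 𝓛 h
  exact ⟨embedHom h H, IsSelfAdjoint.map hH (embedHom h), ℓ, fun j => embedHom h (K j), hΦ⟩

theorem norm_extend_le (h : Z ⊆ Λ) (M : LocalAlg S Λ) :
    ‖extend h (𝓛.L Z) M‖ ≤ cbNorm (𝓛.L Z) * ‖M‖ := by
  rw [extend_apply_eq_tensorExt]
  exact norm_tensorExt_le _ (𝓛.lindblad Z) M

theorem map_extend_of_intertwines (h : Z ⊆ Λ) {φ : LocalAlg S Λ →ₗ[ℂ] LocalAlg S Λ}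
    (hφ : ∀ a ∈ supported S h, Intertwines φ a a) (M : LocalAlg S Λ) :
    φ (extend h (𝓛.L Z) M) = extend h (𝓛.L Z) (φ M) := by
  obtain ⟨H, -, ℓ, K, hΦ⟩ := exists_extend_eq_lindbladForm 𝓛 h
  rw [hΦ, hΦ]
  exact map_lindbladForm (hφ _ ⟨H, rfl⟩) (fun j => hφ _ ⟨K j, rfl⟩)
    (fun j => hφ _ (star_mem (s := supported S h) ⟨K j, rfl⟩)) M

theorem extend_mul_right (h : Z ⊆ Λ) {hX : X ⊆ Λ} (hd : Disjoint Z X) {N : LocalAlg S Λ}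
    (hN : N ∈ supported S hX) (M : LocalAlg S Λ) :
    extend h (𝓛.L Z) (M * N) = extend h (𝓛.L Z) M * N :=
  (map_extend_of_intertwines 𝓛 h (φ := LinearMap.mulRight ℂ N)
    (fun a ha => ⟨fun M => mul_assoc a M N, fun M => by
      simp only [LinearMap.mulRight_apply, mul_assoc, (commute_of_mem_supported hd ha hN).eq]⟩)
    M).symm

theorem extend_mul_left (h : Z ⊆ Λ) {hX : X ⊆ Λ} (hd : Disjoint Z X) {N : LocalAlg S Λ}
    (hN : N ∈ supported S hX) (M : LocalAlg S Λ) :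
    extend h (𝓛.L Z) (N * M) = N * extend h (𝓛.L Z) M :=
  (map_extend_of_intertwines 𝓛 h (φ := LinearMap.mulLeft ℂ N)
    (fun a ha => ⟨fun M => by
      simp only [LinearMap.mulLeft_apply, ← mul_assoc, (commute_of_mem_supported hd ha hN).eq],
      fun M => (mul_assoc N M a).symm⟩) M).symm

theorem extend_eq_zero (h : Z ⊆ Λ) {hX : X ⊆ Λ} (hd : Disjoint Z X) {N : LocalAlg S Λ}
    (hN : N ∈ supported S hX) : extend h (𝓛.L Z) N = 0 := by
  obtain ⟨H, -, ℓ, K, hΦ⟩ := exists_extend_eq_lindbladForm 𝓛 h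
  rw [← mul_one N, extend_mul_left 𝓛 h hd hN, hΦ, lindbladForm_one, mul_zero]

theorem extend_extend_comm {Z' : Finset Γ} (h : Z ⊆ Λ) (h' : Z' ⊆ Λ) (hd : Disjoint Z Z')
    (M : LocalAlg S Λ) :
    extend h (𝓛.L Z) (extend h' (𝓛.L Z') M) = extend h' (𝓛.L Z') (extend h (𝓛.L Z) M) :=
  map_extend_of_intertwines 𝓛 h'
    (fun _ ha => ⟨extend_mul_left 𝓛 h hd ha, extend_mul_right 𝓛 h hd ha⟩) M

theorem extend_mem_supported (h : Z ⊆ Λ) {hX : X ⊆ Λ} (hZX : Z ⊆ X) {N : LocalAlg S Λ}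
    (hN : N ∈ supported S hX) : extend h (𝓛.L Z) N ∈ supported S hX := by
  obtain ⟨H, -, ℓ, K, hΦ⟩ := exists_extend_eq_lindbladForm 𝓛 h
  obtain ⟨A, rfl⟩ := mem_supported.1 hN
  refine mem_supported.2 ⟨lindbladForm (embedHom hZX H) (fun j => embedHom hZX (K j)) A, ?_⟩
  rw [hΦ, ← embedHom_apply, starHom_lindbladForm]
  simp only [embedHom_apply, embed_embed]

/-- The generator consisting of the interaction terms indexed by a family of subsets of `Λ`. -/
def partialGenerator (Λ : Finset Γ) (s : Finset {Z // Z ∈ Λ.powerset}) :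
    LocalAlg S Λ →L[ℂ] LocalAlg S Λ :=
  LinearMap.toContinuousLinearMap (∑ Z ∈ s, extend (Finset.mem_powerset.1 Z.2) (𝓛.L Z))

theorem partialGenerator_apply (s : Finset {Z // Z ∈ Λ.powerset}) (M : LocalAlg S Λ) :
    partialGenerator 𝓛 Λ s M = ∑ Z ∈ s, extend (Finset.mem_powerset.1 Z.2) (𝓛.L Z) M := by
  simp [partialGenerator]

theorem isDissipative_partialGenerator (Λ : Finset Γ) (s : Finset {Z // Z ∈ Λ.powerset}) :
    IsDissipative (partialGenerator 𝓛 Λ s) :=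
  (IsNormDecreasing.sum s fun Z _ =>
    (isLindblad_extend 𝓛 (Finset.mem_powerset.1 Z.2)).isNormDecreasing).isDissipative

end Local

/-! ### Lieb–Robinson bounds -/

section Growth

/-- The temporal factor `M ∫₀ᵗ e^{MCs} ds` in the Lieb–Robinson bound, equal to `(e^{MCt} - 1) / C`
when `C ≠ 0`. -/
def growth (M C t : ℝ) : ℝ := M * ∫ s in 0..t, Real.exp (M * C * s)

theorem growth_zero (M C : ℝ) : growth M C 0 = 0 := by
  simp [growth]

theorem growth_nonneg {M C t : ℝ} (hM : 0 ≤ M) (ht : 0 ≤ t) : 0 ≤ growth M C t :=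
  mul_nonneg hM (intervalIntegral.integral_nonneg ht fun _ _ => (Real.exp_pos _).le)

theorem hasDerivAt_growth (M C t : ℝ) :
    HasDerivAt (growth M C) (M * Real.exp (M * C * t)) t := by
  have hcont : Continuous fun s => Real.exp (M * C * s) := by fun_prop
  exact (hcont.integral_hasStrictDerivAt 0 t).hasDerivAt.const_mul M

theorem one_add_mul_growth (M C t : ℝ) : 1 + C * growth M C t = Real.exp (M * C * t) := by
  have hderiv (s : ℝ) :
      HasDerivAt (fun s => Real.exp (M * C * s)) (C * (M * Real.exp (M * C * s))) s := by
    refine ((hasDerivAt_id s).const_mul (M * C)).exp.congr_deriv ?_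
    simp only [id]
    ring
  have hFTC := intervalIntegral.integral_eq_sub_of_hasDerivAt (a := 0) (b := t)
    (fun s _ => hderiv s) (Continuous.intervalIntegrable (by fun_prop) _ _)
  simp only [intervalIntegral.integral_const_mul, mul_zero, Real.exp_zero] at hFTC
  rw [growth, hFTC, add_sub_cancel]

end Growth

section Reach

variable {Γ : Type*} [DecidableEq Γ]

/-- The spatial factor in the Lieb–Robinson bound: the influence of an interaction term supported
in `Z` on an observable at `w`, when the indirect influence at distance has strength `e`. -/
def reach (f : Γ → Γ → ℝ) (Z : Finset Γ) (e : ℝ) (w : Γ) : ℝ :=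
  (if w ∈ Z then 1 else 0) + e * ∑ z ∈ Z, f z w

theorem reach_nonneg {f : Γ → Γ → ℝ} (hf : ∀ x y, 0 ≤ f x y) (Z : Finset Γ) {e : ℝ} (he : 0 ≤ e)
    (w : Γ) : 0 ≤ reach f Z e w :=
  add_nonneg (by split_ifs <;> norm_num) (mul_nonneg he (Finset.sum_nonneg fun _ _ => hf _ _))

/-- The finite-volume content of `‖𝓛‖_F ≤ M`: weights `c Z` in place of `‖L_Z‖_cb`, a function
`f x y` in place of `F(d(x,y))`, and a convolution constant `C` of `f` on `Λ`. -/
structure IsDecayBound (c : Finset Γ → ℝ) (Λ : Finset Γ) (f : Γ → Γ → ℝ) (M C : ℝ) : Prop where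
  nonneg : ∀ x y, 0 ≤ f x y
  nonneg_weight : ∀ Z, 0 ≤ c Z
  nonneg_const : 0 ≤ M
  sum_le : ∀ x y, ∑ Z : {Z // Z ∈ Λ.powerset} with x ∈ Z.1 ∧ y ∈ Z.1, c Z ≤ M * f x y
  conv : ∀ x y, ∑ z ∈ Λ, f x z * f z y ≤ C * f x y

variable {c : Finset Γ → ℝ} {Λ : Finset Γ} {f : Γ → Γ → ℝ} {M C e : ℝ}

theorem IsDecayBound.sum_filter_le (h : IsDecayBound c Λ f M C)
    (s : Finset {Z // Z ∈ Λ.powerset}) (x y : Γ) :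
    ∑ Z ∈ s with x ∈ Z.1 ∧ y ∈ Z.1, c Z ≤ M * f x y :=
  (Finset.sum_le_sum_of_subset_of_nonneg (Finset.filter_subset_filter _ s.subset_univ)
    fun _ _ _ => h.nonneg_weight _).trans (h.sum_le x y)

theorem IsDecayBound.sum_mul_reach_le_of_mem (h : IsDecayBound c Λ f M C)
    (s : Finset {Z // Z ∈ Λ.powerset}) (he : 0 ≤ e) (y w : Γ) :
    ∑ Z ∈ s with y ∈ Z.1, c Z * reach f Z e w ≤ M * (1 + C * e) * f y w := by
  have hdirect : ∑ Z ∈ s with y ∈ Z.1, c Z * (if w ∈ Z.1 then 1 else 0) ≤ M * f y w := by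
    simp only [mul_ite, mul_one, mul_zero]
    rw [← Finset.sum_filter, Finset.filter_filter]
    exact h.sum_filter_le s y w
  have hindirect : ∑ Z ∈ s with y ∈ Z.1, c Z * ∑ z ∈ Z.1, f z w ≤ M * (C * f y w) :=
    calc ∑ Z ∈ s with y ∈ Z.1, c Z * ∑ z ∈ Z.1, f z w
        = ∑ Z ∈ s with y ∈ Z.1, ∑ z ∈ Λ, if z ∈ Z.1 then c Z * f z w else 0 := by
          refine Finset.sum_congr rfl fun Z _ => ?_
          rw [← Finset.sum_filter, Finset.filter_mem_eq_inter,
            Finset.inter_eq_right.2 (Finset.mem_powerset.1 Z.2), Finset.mul_sum]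
      _ = ∑ z ∈ Λ, (∑ Z ∈ s with y ∈ Z.1 ∧ z ∈ Z.1, c Z) * f z w := by
          rw [Finset.sum_comm]
          refine Finset.sum_congr rfl fun z _ => ?_
          rw [← Finset.sum_filter, Finset.filter_filter, Finset.sum_mul]
      _ ≤ ∑ z ∈ Λ, M * f y z * f z w := Finset.sum_le_sum fun z _ =>
          mul_le_mul_of_nonneg_right (h.sum_filter_le s y z) (h.nonneg _ _)
      _ ≤ M * (C * f y w) := by
          simp only [mul_assoc, ← Finset.mul_sum]
          exact mul_le_mul_of_nonneg_left (h.conv y w) h.nonneg_const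
  calc ∑ Z ∈ s with y ∈ Z.1, c Z * reach f Z e w
      = ∑ Z ∈ s with y ∈ Z.1, c Z * (if w ∈ Z.1 then 1 else 0) +
          e * ∑ Z ∈ s with y ∈ Z.1, c Z * ∑ z ∈ Z.1, f z w := by
        simp only [reach, mul_add, Finset.sum_add_distrib, Finset.mul_sum, mul_left_comm e]
    _ ≤ M * f y w + e * (M * (C * f y w)) :=
        add_le_add hdirect (mul_le_mul_of_nonneg_left hindirect he)
    _ = M * (1 + C * e) * f y w := by ring

theorem IsDecayBound.sum_mul_reach_le (h : IsDecayBound c Λ f M C)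
    {s : Finset {Z // Z ∈ Λ.powerset}} (he : 0 ≤ e) {R : Finset Γ} {w : Γ}
    (hR : ∀ Z ∈ s, ∃ y ∈ R, y ∈ Z.1) :
    ∑ Z ∈ s, c Z * reach f Z e w ≤ M * (1 + C * e) * ∑ y ∈ R, f y w :=
  calc ∑ Z ∈ s, c Z * reach f Z e w
      ≤ ∑ Z ∈ s, ∑ y ∈ R, if y ∈ Z.1 then c Z * reach f Z e w else 0 := by
        refine Finset.sum_le_sum fun Z hZ => ?_
        have hterm : 0 ≤ c Z * reach f Z e w :=
          mul_nonneg (h.nonneg_weight Z) (reach_nonneg h.nonneg Z he w)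
        obtain ⟨y, hy, hyZ⟩ := hR Z hZ
        refine le_trans ?_ (Finset.single_le_sum (fun i _ => ?_) hy)
        · rw [if_pos hyZ]
        · split_ifs <;> [exact hterm; exact le_rfl]
    _ = ∑ y ∈ R, ∑ Z ∈ s with y ∈ Z.1, c Z * reach f Z e w := by
        rw [Finset.sum_comm]
        exact Finset.sum_congr rfl fun y _ => (Finset.sum_filter _ _).symm
    _ ≤ M * (1 + C * e) * ∑ y ∈ R, f y w := by
        rw [Finset.mul_sum]
        exact Finset.sum_le_sum fun y _ => h.sum_mul_reach_le_of_mem s he y w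

theorem IsDecayBound.sum_mul_sum_reach_growth_le (h : IsDecayBound c Λ f M C)
    {s : Finset {Z // Z ∈ Λ.powerset}} {W : Finset Γ} {R : Γ → Finset Γ}
    (hR : ∀ w ∈ W, ∀ Z ∈ s, ∃ y ∈ R w, y ∈ Z.1) {t : ℝ} (ht : 0 ≤ t) :
    ∑ Z ∈ s, c Z * ∑ w ∈ W, reach f Z (growth M C t) w ≤
      M * Real.exp (M * C * t) * ∑ w ∈ W, ∑ y ∈ R w, f y w := by
  simp only [Finset.mul_sum]
  rw [Finset.sum_comm, ← one_add_mul_growth]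
  simp only [← Finset.mul_sum]
  rw [Finset.mul_sum]
  exact Finset.sum_le_sum fun w hw =>
    h.sum_mul_reach_le (growth_nonneg h.nonneg_const ht) (hR w hw)

end Reach

section LiebRobinson

variable {Γ : Type*} [DecidableEq Γ] {S : Γ → Type*} [∀ x, Fintype (S x)] [∀ x, DecidableEq (S x)]

/-- The semigroup generated by a subfamily of the interaction terms. -/
abbrev partialDynamics (𝓛 : Interaction S) (Λ : Finset Γ) (s : Finset {Z // Z ∈ Λ.powerset})
    (t : ℝ) : LocalAlg S Λ →L[ℂ] LocalAlg S Λ :=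
  semigroup (partialGenerator 𝓛 Λ s) t

variable {𝓛 : Interaction S} {Λ : Finset Γ}

theorem norm_partialGenerator_apply_le (s : Finset {Z // Z ∈ Λ.powerset}) (A : LocalAlg S Λ) :
    ‖partialGenerator 𝓛 Λ s A‖ ≤ ∑ Z ∈ s, ‖extend (Finset.mem_powerset.1 Z.2) (𝓛.L Z) A‖ :=
  partialGenerator_apply 𝓛 s A ▸ norm_sum_le _ _

/-- The terms of the generator whose support is disjoint from `Z` commute with `L_Z`, so only the
others contribute to the growth of `‖L_Z (T_t A)‖`. -/
theorem norm_extend_partialDynamics_le (s : Finset {Z // Z ∈ Λ.powerset})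
    (Z : {Z // Z ∈ Λ.powerset}) (A : LocalAlg S Λ) {P P' : ℝ → ℝ} {t : ℝ} (ht : 0 ≤ t)
    (hP : ∀ r, HasDerivAt P (P' r) r)
    (hbound : ∀ r, 0 ≤ r → ∑ Z' ∈ s with ¬ Disjoint Z.1 Z'.1,
      ‖extend (Finset.mem_powerset.1 Z'.2) (𝓛.L Z') (partialDynamics 𝓛 Λ s r A)‖ ≤ P' r) :
    ‖extend (Finset.mem_powerset.1 Z.2) (𝓛.L Z) (partialDynamics 𝓛 Λ s t A)‖ ≤
      ‖extend (Finset.mem_powerset.1 Z.2) (𝓛.L Z) A‖ + cbNorm (𝓛.L Z) * (P t - P 0) := by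
  set s₁ := s.filter fun Z' => Disjoint Z.1 Z'.1
  set s₂ := s.filter fun Z' => ¬ Disjoint Z.1 Z'.1
  let K := LinearMap.toContinuousLinearMap (extend (Finset.mem_powerset.1 Z.2) (𝓛.L Z))
  have hsplit : partialGenerator 𝓛 Λ s = partialGenerator 𝓛 Λ s₁ + partialGenerator 𝓛 Λ s₂ := by
    ext1 M
    simp only [_root_.add_apply, partialGenerator_apply]
    exact (Finset.sum_filter_add_sum_filter_not s _ _).symm
  have hcomm (M : LocalAlg S Λ) :
      K (partialGenerator 𝓛 Λ s₁ M) = partialGenerator 𝓛 Λ s₁ (K M) := by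
    rw [partialGenerator_apply, partialGenerator_apply, map_sum]
    exact Finset.sum_congr rfl fun Z' hZ' =>
      extend_extend_comm 𝓛 _ _ (Finset.mem_filter.1 hZ').2 M
  have hsource (r : ℝ) (hr : 0 ≤ r) : ‖K (partialGenerator 𝓛 Λ s₂ (partialDynamics 𝓛 Λ s r A))‖ ≤
      cbNorm (𝓛.L Z) * P' r :=
    (norm_extend_le 𝓛 _ _).trans (mul_le_mul_of_nonneg_left
      ((norm_partialGenerator_apply_le _ _).trans (hbound r hr)) (cbNorm_nonneg _))
  simp only [partialDynamics, hsplit] at hsource ⊢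
  rw [mul_sub]
  exact norm_apply_semigroup_add_le (isDissipative_partialGenerator 𝓛 Λ s₁) hcomm A ht
    (fun r => (hP r).const_mul _) hsource

theorem norm_extend_le_of_mem_supported (Z : {Z // Z ∈ Λ.powerset}) {W : Finset Γ} {hW : W ⊆ Λ}
    {A : LocalAlg S Λ} (hA : A ∈ supported S hW) :
    ‖extend (Finset.mem_powerset.1 Z.2) (𝓛.L Z) A‖ ≤
      cbNorm (𝓛.L Z) * (‖A‖ * ∑ w ∈ W, if w ∈ Z.1 then 1 else 0) := by
  have hcount : (∑ w ∈ W, if w ∈ Z.1 then (1 : ℝ) else 0) = (W ∩ Z.1).card := by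
    rw [Finset.sum_boole, Finset.filter_mem_eq_inter]
  rw [hcount]
  obtain hWZ | hWZ := (W ∩ Z.1).eq_empty_or_nonempty
  · rw [extend_eq_zero 𝓛 _ (Finset.disjoint_iff_inter_eq_empty.2 hWZ).symm hA]
    simp [hWZ]
  · refine (norm_extend_le 𝓛 _ _).trans (mul_le_mul_of_nonneg_left ?_ (cbNorm_nonneg _))
    exact le_mul_of_one_le_right (norm_nonneg A) (Nat.one_le_cast.2 hWZ.card_pos)

variable {f : Γ → Γ → ℝ} {M C : ℝ}

theorem hasDerivAt_mul_growth_add_pow (M C q κ : ℝ) (n : ℕ) (r : ℝ) :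
    HasDerivAt (fun r => q * growth M C r + (κ * r) ^ (n + 1) / (n + 1).factorial)
      (M * Real.exp (M * C * r) * q + κ * ((κ * r) ^ n / n.factorial)) r := by
  have hpow := (((hasDerivAt_id r).const_mul κ).pow (n + 1)).div_const ((n + 1).factorial : ℝ)
  refine (((hasDerivAt_growth M C r).const_mul q).add hpow).congr_deriv ?_
  rw [Nat.factorial_succ]
  simp only [id, Nat.cast_mul, add_tsub_cancel_right]
  field_simp

/-- The `n`-fold iteration of Duhamel's formula; the last summand is the remainder, which tends
to `0` as `n → ∞`. -/
theorem norm_extend_partialDynamics_le_add_pow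
    (h : IsDecayBound (fun Z => cbNorm (𝓛.L Z)) Λ f M C) (s : Finset {Z // Z ∈ Λ.powerset})
    {W : Finset Γ} {hW : W ⊆ Λ} {A : LocalAlg S Λ} (hA : A ∈ supported S hW) (n : ℕ)
    (Z : {Z // Z ∈ Λ.powerset}) {t : ℝ} (ht : 0 ≤ t) :
    ‖extend (Finset.mem_powerset.1 Z.2) (𝓛.L Z) (partialDynamics 𝓛 Λ s t A)‖ ≤
      cbNorm (𝓛.L Z) * (‖A‖ * (∑ w ∈ W, reach f Z (growth M C t) w +
        ((∑ Z ∈ s, cbNorm (𝓛.L Z)) * t) ^ n / n.factorial)) := by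
  set κ := ∑ Z ∈ s, cbNorm (𝓛.L Z)
  have hκ0 : 0 ≤ κ := Finset.sum_nonneg fun _ _ => cbNorm_nonneg _
  induction n generalizing Z t with
  | zero =>
    refine (norm_extend_le 𝓛 _ _).trans (mul_le_mul_of_nonneg_left ?_ (cbNorm_nonneg _))
    refine (norm_semigroup_le (isDissipative_partialGenerator 𝓛 Λ s) ht A).trans
      (le_mul_of_one_le_right (norm_nonneg _) ?_)
    simpa using Finset.sum_nonneg fun w _ =>
      reach_nonneg h.nonneg Z.1 (growth_nonneg h.nonneg_const ht) w
  | succ n ih =>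
    set q := ∑ w ∈ W, ∑ z ∈ Z.1, f z w with hq
    have hbound (r : ℝ) (hr : 0 ≤ r) : ∑ Z' ∈ s with ¬ Disjoint Z.1 Z'.1,
        ‖extend (Finset.mem_powerset.1 Z'.2) (𝓛.L Z') (partialDynamics 𝓛 Λ s r A)‖ ≤
          ‖A‖ * (M * Real.exp (M * C * r) * q + κ * ((κ * r) ^ n / n.factorial)) := by
      refine (Finset.sum_le_sum fun Z' _ => ih Z' hr).trans ?_
      simp only [mul_left_comm _ ‖A‖, ← Finset.mul_sum, mul_add, Finset.sum_add_distrib,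
        ← Finset.sum_mul]
      gcongr
      · exact h.sum_mul_sum_reach_growth_le (R := fun _ => Z.1) (fun w _ Z' hZ' =>
          Finset.not_disjoint_iff.1 (Finset.mem_filter.1 hZ').2) hr
      · exact Finset.sum_le_sum_of_subset_of_nonneg (Finset.filter_subset _ _)
          fun _ _ _ => cbNorm_nonneg _
    refine (norm_extend_partialDynamics_le s Z A ht (fun r =>
      (hasDerivAt_mul_growth_add_pow M C q κ n r).const_mul ‖A‖) hbound).trans
        ((add_le_add_left (norm_extend_le_of_mem_supported Z hA) _).trans_eq ?_)
    simp only [reach, Finset.sum_add_distrib, ← Finset.mul_sum, growth_zero, mul_zero, ne_eq,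
      Nat.succ_ne_zero, not_false_eq_true, zero_pow, zero_div, ← hq]
    ring

theorem lieb_robinson (h : IsDecayBound (fun Z => cbNorm (𝓛.L Z)) Λ f M C)
    (s : Finset {Z // Z ∈ Λ.powerset}) {W : Finset Γ} {hW : W ⊆ Λ} {A : LocalAlg S Λ}
    (hA : A ∈ supported S hW) (Z : {Z // Z ∈ Λ.powerset}) {t : ℝ} (ht : 0 ≤ t) :
    ‖extend (Finset.mem_powerset.1 Z.2) (𝓛.L Z) (partialDynamics 𝓛 Λ s t A)‖ ≤
      cbNorm (𝓛.L Z) * (‖A‖ * ∑ w ∈ W, reach f Z (growth M C t) w) := by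
  have hlim := (((FloorSemiring.tendsto_pow_div_factorial_atTop
    ((∑ Z ∈ s, cbNorm (𝓛.L Z)) * t)).const_add
      (∑ w ∈ W, reach f Z (growth M C t) w)).const_mul ‖A‖).const_mul (cbNorm (𝓛.L Z))
  rw [add_zero] at hlim
  exact ge_of_tendsto' hlim fun n => norm_extend_partialDynamics_le_add_pow h s hA n Z ht

theorem norm_partialDynamics_univ_sub_le (h : IsDecayBound (fun Z => cbNorm (𝓛.L Z)) Λ f M C)
    (s : Finset {Z // Z ∈ Λ.powerset}) {W : Finset Γ} {hW : W ⊆ Λ} {A : LocalAlg S Λ}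
    (hA : A ∈ supported S hW) {R : Γ → Finset Γ}
    (hR : ∀ w ∈ W, ∀ Z ∉ s, ∃ y ∈ R w, y ∈ Z.1) {t : ℝ} (ht : 0 ≤ t) :
    ‖partialDynamics 𝓛 Λ Finset.univ t A - partialDynamics 𝓛 Λ s t A‖ ≤
      ‖A‖ * (growth M C t * ∑ w ∈ W, ∑ y ∈ R w, f y w) := by
  set G := ∑ w ∈ W, ∑ y ∈ R w, f y w
  have hremoved (M : LocalAlg S Λ) : partialGenerator 𝓛 Λ Finset.univ M - partialGenerator 𝓛 Λ s M =
      partialGenerator 𝓛 Λ sᶜ M := by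
    simp only [partialGenerator_apply, sub_eq_iff_eq_add', Finset.sum_add_sum_compl]
  have hsource (r : ℝ) (hr : 0 ≤ r) :
      ‖partialGenerator 𝓛 Λ Finset.univ (partialDynamics 𝓛 Λ s r A) -
        partialGenerator 𝓛 Λ s (partialDynamics 𝓛 Λ s r A)‖ ≤
          ‖A‖ * (M * Real.exp (M * C * r) * G) := by
    rw [hremoved]
    refine (norm_partialGenerator_apply_le _ _).trans
      ((Finset.sum_le_sum fun Z _ => lieb_robinson h s hA Z hr).trans ?_)
    simp only [mul_left_comm _ ‖A‖, ← Finset.mul_sum]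
    exact mul_le_mul_of_nonneg_left (h.sum_mul_sum_reach_growth_le
      (fun w hw Z hZ => hR w hw Z (Finset.mem_compl.1 hZ)) hr) (norm_nonneg A)
  refine (norm_semigroup_sub_semigroup_le (isDissipative_partialGenerator 𝓛 Λ Finset.univ) A ht
    (fun r => ((hasDerivAt_growth M C r).mul_const G).const_mul ‖A‖) hsource).trans_eq ?_
  simp only [growth_zero, zero_mul, mul_zero, sub_zero]

end LiebRobinson

/-! ### `F`-functions -/

section FFunction

variable {Γ : Type*} [MetricSpace Γ] {F : ℝ → ℝ} {a : ℝ}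

theorem IsFFunction.pos_dist (hF : IsFFunction Γ F) (x y : Γ) : 0 < F (dist x y) :=
  hF.pos _ dist_nonneg

theorem expWeight_pos {r : ℝ} (hF : 0 < F r) : 0 < expWeight a F r :=
  mul_pos (Real.exp_pos _) hF

theorem expWeight_le {r : ℝ} (ha : 0 ≤ a) (hr : 0 ≤ r) (hF : 0 ≤ F r) : expWeight a F r ≤ F r :=
  mul_le_of_le_one_left hF (Real.exp_le_one_iff.2 (neg_nonpos.2 (mul_nonneg ha hr)))

theorem expWeight_mul_expWeight_le (ha : 0 ≤ a) {r r₁ r₂ : ℝ} (hr : r ≤ r₁ + r₂)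
    (hF₁ : 0 ≤ F r₁) (hF₂ : 0 ≤ F r₂) :
    expWeight a F r₁ * expWeight a F r₂ ≤ Real.exp (-(a * r)) * (F r₁ * F r₂) :=
  calc expWeight a F r₁ * expWeight a F r₂ = Real.exp (-(a * (r₁ + r₂))) * (F r₁ * F r₂) := by
        rw [mul_add, neg_add, Real.exp_add, expWeight, expWeight]
        ring
    _ ≤ Real.exp (-(a * r)) * (F r₁ * F r₂) := by gcongr

theorem isFFunction_expWeight (hF : IsFFunction Γ F) (ha : 0 ≤ a) :
    IsFFunction Γ (expWeight a F) := by
  have hpos (x y : Γ) : 0 < expWeight a F (dist x y) := expWeight_pos (hF.pos_dist x y)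
  have hle (x y : Γ) : expWeight a F (dist x y) ≤ F (dist x y) :=
    expWeight_le ha dist_nonneg (hF.pos_dist x y).le
  have hsummable (x : Γ) : Summable fun y => expWeight a F (dist x y) :=
    (hF.summable x).of_nonneg_of_le (fun y => (hpos x y).le) (hle x)
  refine ⟨fun r hr => expWeight_pos (hF.pos r hr), fun r hr r' hr' hrr' => ?_, hsummable, ?_, ?_⟩
  · exact mul_le_mul (Real.exp_le_exp.2 (neg_le_neg (mul_le_mul_of_nonneg_left hrr' ha)))
      (hF.antitone hr hr' hrr') (hF.pos r' hr').le (Real.exp_pos _).le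
  · exact hF.bounded.range_mono _ fun x => (hsummable x).tsum_le_tsum (hle x) (hF.summable x)
  · obtain ⟨C, hC, hconv⟩ := hF.convolution
    refine ⟨C, hC, fun x y => ?_⟩
    have hle_conv (z : Γ) : expWeight a F (dist x z) * expWeight a F (dist z y) ≤
        Real.exp (-(a * dist x y)) * (F (dist x z) * F (dist z y)) :=
      expWeight_mul_expWeight_le ha (dist_triangle x z y) (hF.pos_dist x z).le (hF.pos_dist z y).le
    have hs := (hconv x y).1.mul_left (Real.exp (-(a * dist x y)))
    have hs' := hs.of_nonneg_of_le (fun z => (mul_pos (hpos x z) (hpos z y)).le) hle_conv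
    refine ⟨hs', (hs'.tsum_le_tsum hle_conv hs).trans ?_⟩
    rw [tsum_mul_left, expWeight, mul_left_comm]
    exact mul_le_mul_of_nonneg_left (hconv x y).2 (Real.exp_pos _).le

theorem IsFFunction.FFunNorm_nonneg (hF : IsFFunction Γ F) : 0 ≤ FFunNorm Γ F :=
  Real.iSup_nonneg fun x => tsum_nonneg fun y => (hF.pos_dist x y).le

theorem convConst_nonneg (Γ : Type*) [MetricSpace Γ] (F : ℝ → ℝ) : 0 ≤ convConst Γ F :=
  Real.sInf_nonneg fun _ hC => hC.1.le

theorem IsFFunction.convConst_pos [Nonempty Γ] (hF : IsFFunction Γ F) : 0 < convConst Γ F := by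
  inhabit Γ
  let x : Γ := default
  refine (hF.pos_dist x x).trans_le (le_csInf hF.convolution fun C hC => ?_)
  have hdiag := (hC.2 x x).1.le_tsum x fun z _ => (mul_pos (hF.pos_dist x z) (hF.pos_dist z x)).le
  exact le_of_mul_le_mul_right (hdiag.trans (hC.2 x x).2) (hF.pos_dist x x)

theorem IsFFunction.sum_conv_le (hF : IsFFunction Γ F) (Λ : Finset Γ) (x y : Γ) :
    ∑ z ∈ Λ, F (dist x z) * F (dist z y) ≤ convConst Γ F * F (dist x y) := by
  rw [← div_le_iff₀ (hF.pos_dist x y)]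
  refine le_csInf hF.convolution fun C hC => ?_
  rw [div_le_iff₀ (hF.pos_dist x y)]
  exact ((hC.2 x y).1.sum_le_tsum Λ fun z _ =>
    (mul_pos (hF.pos_dist x z) (hF.pos_dist z y)).le).trans (hC.2 x y).2

theorem IsFFunction.sum_expWeight_le (hF : IsFFunction Γ F) (ha : 0 ≤ a) {r : ℝ}
    {s : Finset Γ} {w : Γ} (hs : ∀ y ∈ s, r ≤ dist y w) :
    ∑ y ∈ s, expWeight a F (dist y w) ≤ Real.exp (-(a * r)) * FFunNorm Γ F :=
  calc ∑ y ∈ s, expWeight a F (dist y w)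
      ≤ ∑ y ∈ s, Real.exp (-(a * r)) * F (dist w y) := by
        refine Finset.sum_le_sum fun y hy => ?_
        rw [expWeight, dist_comm w y]
        exact mul_le_mul_of_nonneg_right (Real.exp_le_exp.2 (neg_le_neg
          (mul_le_mul_of_nonneg_left (hs y hy) ha))) (hF.pos_dist y w).le
    _ = Real.exp (-(a * r)) * ∑ y ∈ s, F (dist w y) := (Finset.mul_sum _ _ _).symm
    _ ≤ Real.exp (-(a * r)) * FFunNorm Γ F := mul_le_mul_of_nonneg_left
        (((hF.summable w).sum_le_tsum s fun y _ => (hF.pos_dist w y).le).trans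
          (le_ciSup hF.bounded w)) (Real.exp_pos _).le

variable [DecidableEq Γ] {S : Γ → Type*} [∀ x, Fintype (S x)] [∀ x, DecidableEq (S x)]
  {𝓛 : Interaction S}

theorem FNorm_nonneg (hF : IsFFunction Γ F) : 0 ≤ FNorm 𝓛 F := by
  cases isEmpty_or_nonempty Γ
  · have : {M | IsFBound 𝓛 F M} = Set.univ := Set.eq_univ_of_forall fun M x => isEmptyElim x
    rw [FNorm, this, Real.sInf_univ]
  · inhabit Γ
    refine Real.sInf_nonneg fun M hM => ?_
    exact nonneg_of_mul_nonneg_left ((tsum_nonneg fun Z => cbNorm_nonneg _).trans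
      (hM default default).2) (hF.pos_dist default default)

theorem sum_cbNorm_le (hF : IsFFunction Γ F) (h𝓛 : HasFiniteFNorm 𝓛 F) (Λ : Finset Γ) (x y : Γ) :
    ∑ Z : {Z // Z ∈ Λ.powerset} with x ∈ Z.1 ∧ y ∈ Z.1, cbNorm (𝓛.L Z) ≤
      FNorm 𝓛 F * F (dist x y) := by
  rw [← div_le_iff₀ (hF.pos_dist x y)]
  refine le_csInf h𝓛 fun M hM => ?_
  rw [div_le_iff₀ (hF.pos_dist x y)]
  refine le_trans (le_of_eq ?_) (((hM x y).1.sum_le_tsum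
    (Λ.powerset.subtype fun Z => x ∈ Z ∧ y ∈ Z) fun Z _ => cbNorm_nonneg _).trans (hM x y).2)
  rw [Finset.sum_filter, Finset.sum_coe_sort Λ.powerset
    (fun Z => if x ∈ Z ∧ y ∈ Z then cbNorm (𝓛.L Z) else 0), ← Finset.sum_filter]
  exact (Finset.sum_subtype_eq_sum_filter fun Z => cbNorm (𝓛.L Z)).symm

theorem isDecayBound_cbNorm (hF : IsFFunction Γ F) (h𝓛 : HasFiniteFNorm 𝓛 F) (Λ : Finset Γ) :
    IsDecayBound (fun Z => cbNorm (𝓛.L Z)) Λ (fun x y => F (dist x y)) (FNorm 𝓛 F)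
      (convConst Γ F) where
  nonneg x y := (hF.pos_dist x y).le
  nonneg_weight _ := cbNorm_nonneg _
  nonneg_const := FNorm_nonneg hF
  sum_le := sum_cbNorm_le hF h𝓛 Λ
  conv := hF.sum_conv_le Λ

end FFunction

/-! ### Decoupled dynamics -/

section Decoupling

variable {Γ : Type*} [DecidableEq Γ] {Λ U V : Finset Γ}

/-- The subsets of `Λ` contained in `U` or in `V`, indexing the terms of the decoupled
generator. -/
def splitFamily (Λ U V : Finset Γ) : Finset {Z // Z ∈ Λ.powerset} :=
  {Z | Z.1 ⊆ U ∨ Z.1 ⊆ V}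

theorem mem_splitFamily {Z : {Z // Z ∈ Λ.powerset}} :
    Z ∈ splitFamily Λ U V ↔ Z.1 ⊆ U ∨ Z.1 ⊆ V := by
  simp only [splitFamily, Finset.mem_filter_univ]

theorem splitFamily_comm (Λ U V : Finset Γ) : splitFamily Λ U V = splitFamily Λ V U := by
  simp only [splitFamily, or_comm]

variable {S : Γ → Type*} [∀ x, Fintype (S x)] [∀ x, DecidableEq (S x)] (𝓛 : Interaction S)

theorem partialGenerator_splitFamily_mem {hU : U ⊆ Λ} (hd : Disjoint U V) {P : LocalAlg S Λ}
    (hP : P ∈ supported S hU) :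
    partialGenerator 𝓛 Λ (splitFamily Λ U V) P ∈ supported S hU := by
  rw [partialGenerator_apply]
  refine sum_mem fun Z hZ => ?_
  obtain hZU | hZV := mem_splitFamily.1 hZ
  · exact extend_mem_supported 𝓛 _ hZU hP
  · rw [extend_eq_zero 𝓛 _ (hd.symm.mono_left hZV) hP]
    exact zero_mem _

theorem partialGenerator_splitFamily_mul {hU : U ⊆ Λ} {hV : V ⊆ Λ} (hd : Disjoint U V)
    {P Q : LocalAlg S Λ} (hP : P ∈ supported S hU) (hQ : Q ∈ supported S hV) :
    partialGenerator 𝓛 Λ (splitFamily Λ U V) (P * Q) =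
      partialGenerator 𝓛 Λ (splitFamily Λ U V) P * Q +
        P * partialGenerator 𝓛 Λ (splitFamily Λ U V) Q := by
  simp only [partialGenerator_apply]
  rw [Finset.sum_mul, Finset.mul_sum, ← Finset.sum_add_distrib]
  refine Finset.sum_congr rfl fun Z hZ => ?_
  obtain hZU | hZV := mem_splitFamily.1 hZ
  · have hZV := hd.mono_left hZU
    rw [extend_mul_right 𝓛 _ hZV hQ, extend_eq_zero 𝓛 _ hZV hQ, mul_zero, add_zero]
  · have hZU := hd.symm.mono_left hZV
    rw [extend_mul_left 𝓛 _ hZU hP, extend_eq_zero 𝓛 _ hZU hP, zero_mul, zero_add]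

theorem diagState_partialDynamics_splitFamily_mul {hU : U ⊆ Λ} {hV : V ⊆ Λ} (hd : Disjoint U V)
    (σ : Config S Λ) {P Q : LocalAlg S Λ} (hP : P ∈ supported S hU) (hQ : Q ∈ supported S hV)
    (t : ℝ) :
    diagState σ (partialDynamics 𝓛 Λ (splitFamily Λ U V) t (P * Q)) =
      diagState σ (partialDynamics 𝓛 Λ (splitFamily Λ U V) t P) *
        diagState σ (partialDynamics 𝓛 Λ (splitFamily Λ U V) t Q) := by
  let MU := Subalgebra.toSubmodule (supported S hU).toSubalgebra
  let MV := Subalgebra.toSubmodule (supported S hV).toSubalgebra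
  have hMU (M) (hM : M ∈ MU) : partialGenerator 𝓛 Λ (splitFamily Λ U V) M ∈ MU :=
    partialGenerator_splitFamily_mem 𝓛 hd hM
  have hMV (M) (hM : M ∈ MV) : partialGenerator 𝓛 Λ (splitFamily Λ U V) M ∈ MV :=
    splitFamily_comm Λ V U ▸ partialGenerator_splitFamily_mem 𝓛 hd.symm hM
  rw [semigroup_mul (M := MU) (N := MV) (isClosed_supported hU) (isClosed_supported hV) hMU hMV
    (fun _ hp _ hq => partialGenerator_splitFamily_mul 𝓛 hd hp hq) hP hQ]
  exact diagState_mul hd σ (semigroup_mem (M := MU) (isClosed_supported hU) hMU hP t)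
    (semigroup_mem (M := MV) (isClosed_supported hV) hMV hQ t)

end Decoupling

section Neighbourhood

variable {Γ : Type*} [MetricSpace Γ] {Λ X Y : Finset Γ} {r : ℝ}

theorem setDist_le_dist {x y : Γ} (hx : x ∈ X) (hy : y ∈ Y) : setDist X Y ≤ dist x y :=
  ciInf_le (f := fun p : {x // x ∈ X} × {y // y ∈ Y} => dist (p.1 : Γ) (p.2 : Γ))
    (Set.finite_range _).bddBelow (⟨x, hx⟩, ⟨y, hy⟩)

open Classical in
/-- The points of `Λ` at distance less than `r` from some point of `X`. -/
def nbhd (Λ X : Finset Γ) (r : ℝ) : Finset Γ := {y ∈ Λ | ∃ x ∈ X, dist y x < r}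

theorem mem_nbhd {y : Γ} : y ∈ nbhd Λ X r ↔ y ∈ Λ ∧ ∃ x ∈ X, dist y x < r := by
  simp only [nbhd, Finset.mem_filter]

theorem nbhd_subset (Λ X : Finset Γ) (r : ℝ) : nbhd Λ X r ⊆ Λ := fun _ hy => (mem_nbhd.1 hy).1

theorem subset_nbhd (hX : X ⊆ Λ) (hr : 0 < r) : X ⊆ nbhd Λ X r :=
  fun x hx => mem_nbhd.2 ⟨hX hx, x, hx, by rwa [dist_self]⟩

theorem disjoint_nbhd (Λ X Y : Finset Γ) :
    Disjoint (nbhd Λ X (setDist X Y / 2)) (nbhd Λ Y (setDist X Y / 2)) := by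
  refine Finset.disjoint_left.2 fun z hzX hzY => ?_
  obtain ⟨-, x, hx, hxz⟩ := mem_nbhd.1 hzX
  obtain ⟨-, y, hy, hyz⟩ := mem_nbhd.1 hzY
  linarith [setDist_le_dist hx hy, dist_triangle_left x y z]

variable [DecidableEq Γ] {S : Γ → Type*} [∀ x, Fintype (S x)] [∀ x, DecidableEq (S x)]
  {𝓛 : Interaction S} {F : ℝ → ℝ} {a M C : ℝ}

theorem norm_partialDynamics_sub_splitFamily_nbhd_le (hF : IsFFunction Γ F) (ha : 0 ≤ a)
    (h : IsDecayBound (fun Z => cbNorm (𝓛.L Z)) Λ (fun x y => expWeight a F (dist x y)) M C)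
    {W : Finset Γ} {hW : W ⊆ Λ} (hWXY : W ⊆ X ∪ Y) {A : LocalAlg S Λ} (hA : A ∈ supported S hW)
    {t : ℝ} (ht : 0 ≤ t) :
    ‖partialDynamics 𝓛 Λ Finset.univ t A -
        partialDynamics 𝓛 Λ (splitFamily Λ (nbhd Λ X r) (nbhd Λ Y r)) t A‖ ≤
      W.card * (growth M C t * (Real.exp (-(a * r)) * FFunNorm Γ F)) * ‖A‖ := by
  classical
  let far (w : Γ) : Finset Γ := {y ∈ Λ | r ≤ dist y w}
  have hfar {V Z : Finset Γ} (hZ : Z ⊆ Λ) (hZV : ¬ Z ⊆ nbhd Λ V r) {w : Γ} (hw : w ∈ V) :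
      ∃ y ∈ far w, y ∈ Z := by
    obtain ⟨y, hyZ, hyV⟩ := Finset.not_subset.1 hZV
    have hyw : r ≤ dist y w := not_lt.1 fun hlt => hyV (mem_nbhd.2 ⟨hZ hyZ, w, hw, hlt⟩)
    exact ⟨y, Finset.mem_filter.2 ⟨hZ hyZ, hyw⟩, hyZ⟩
  have hremoved (w) (hw : w ∈ W) (Z) (hZ : Z ∉ splitFamily Λ (nbhd Λ X r) (nbhd Λ Y r)) :
      ∃ y ∈ far w, y ∈ Z.1 := by
    obtain ⟨hZX, hZY⟩ := not_or.1 (mt mem_splitFamily.2 hZ)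
    obtain hw | hw := Finset.mem_union.1 (hWXY hw)
    · exact hfar (Finset.mem_powerset.1 Z.2) hZX hw
    · exact hfar (Finset.mem_powerset.1 Z.2) hZY hw
  have htail : ∑ w ∈ W, ∑ y ∈ far w, expWeight a F (dist y w) ≤
      W.card * (Real.exp (-(a * r)) * FFunNorm Γ F) := by
    rw [← nsmul_eq_mul]
    exact Finset.sum_le_card_nsmul _ _ _ fun w _ => hF.sum_expWeight_le ha fun y hy =>
      (Finset.mem_filter.1 hy).2
  refine (norm_partialDynamics_univ_sub_le h _ hA hremoved ht).trans ?_
  rw [mul_comm ‖A‖, mul_left_comm (W.card : ℝ)]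
  gcongr
  exact growth_nonneg h.nonneg_const ht

end Neighbourhood

/-! ### Clustering -/

section Covariance

variable {R : Type*} [SeminormedRing R]

/-- The covariance `φ(PQ) - φ(P)φ(Q)` of two observables in an expectation `φ`. -/
def covariance (φ : R → ℂ) (P Q : R) : ℂ := φ (P * Q) - φ P * φ Q

theorem norm_covariance_sub_covariance_le {φ ψ : R → ℂ} (hφ : ∀ N, ‖φ N‖ ≤ ‖N‖)
    (hψ : ∀ N, ‖ψ N‖ ≤ ‖N‖) {P Q : R} {ε₁ ε₂ ε₃ : ℝ}
    (hPQ : ‖φ (P * Q) - ψ (P * Q)‖ ≤ ε₁ * ‖P * Q‖) (hP : ‖φ P - ψ P‖ ≤ ε₂ * ‖P‖)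
    (hQ : ‖φ Q - ψ Q‖ ≤ ε₃ * ‖Q‖) (hε₁ : 0 ≤ ε₁) :
    ‖covariance φ P Q - covariance ψ P Q‖ ≤ (ε₁ + ε₂ + ε₃) * (‖P‖ * ‖Q‖) :=
  calc ‖covariance φ P Q - covariance ψ P Q‖
      = ‖(φ (P * Q) - ψ (P * Q)) - (φ P - ψ P) * φ Q - ψ P * (φ Q - ψ Q)‖ := by
        rw [covariance, covariance]
        ring_nf
    _ ≤ ‖φ (P * Q) - ψ (P * Q)‖ + ‖φ P - ψ P‖ * ‖φ Q‖ + ‖ψ P‖ * ‖φ Q - ψ Q‖ := by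
        rw [← norm_mul, ← norm_mul]
        exact (norm_sub_le _ _).trans (add_le_add_left (norm_sub_le _ _) _)
    _ ≤ ε₁ * (‖P‖ * ‖Q‖) + ε₂ * ‖P‖ * ‖Q‖ + ‖P‖ * (ε₃ * ‖Q‖) := by
        gcongr
        · exact hPQ.trans (mul_le_mul_of_nonneg_left (norm_mul_le P Q) hε₁)
        · exact (norm_nonneg _).trans hP
        · exact hφ Q
        · exact hψ P
    _ = (ε₁ + ε₂ + ε₃) * (‖P‖ * ‖Q‖) := by ring

end Covariance

section Clustering

variable {Γ : Type*} [DecidableEq Γ] {S : Γ → Type*} [∀ x, Fintype (S x)] [∀ x, DecidableEq (S x)]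
  {𝓛 : Interaction S} {Λ X Y : Finset Γ} {ω : LocalAlg S Λ →ₗ[ℂ] ℂ} {t : ℝ}

theorem IsState.norm_apply_partialDynamics_le (hω : IsState ω) (s : Finset {Z // Z ∈ Λ.powerset})
    (ht : 0 ≤ t) (N : LocalAlg S Λ) : ‖ω (partialDynamics 𝓛 Λ s t N)‖ ≤ ‖N‖ :=
  (hω.norm_apply_le _).trans (norm_semigroup_le (isDissipative_partialGenerator 𝓛 Λ s) ht N)

theorem dynamics_eq_partialDynamics_univ (𝓛 : Interaction S) (Λ : Finset Γ) (t : ℝ) :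
    dynamics 𝓛 Λ t = partialDynamics 𝓛 Λ Finset.univ t := rfl

theorem IsLocalDynamicalFixedPoint.norm_covariance_sub_le {π : LocalAlg S Λ →ₗ[ℂ] ℂ} {g : ℝ → ℝ}
    (hπ : IsLocalDynamicalFixedPoint 𝓛 Λ π g) (hω : IsState ω) (ht : 0 ≤ t) (P Q : LocalAlg S Λ) :
    ‖covariance π P Q - covariance (fun N => ω (dynamics 𝓛 Λ t N)) P Q‖ ≤
      3 * g t * (‖P‖ * ‖Q‖) := by
  have hconv (N : LocalAlg S Λ) : ‖π N - ω (dynamics 𝓛 Λ t N)‖ ≤ g t * ‖N‖ := by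
    simpa only [hπ.invariant t ht N] using hπ.convergence ω hω N t ht
  refine (norm_covariance_sub_covariance_le hπ.isState.norm_apply_le
    (hω.norm_apply_partialDynamics_le Finset.univ ht) (hconv _) (hconv _) (hconv _)
    (hπ.range t ht).1).trans_eq ?_
  ring

theorem covariance_diagState_splitFamily_eq_zero (𝓛 : Interaction S) {U V : Finset Γ} {hU : U ⊆ Λ}
    {hV : V ⊆ Λ} (hd : Disjoint U V) (σ : Config S Λ) {P Q : LocalAlg S Λ}
    (hP : P ∈ supported S hU) (hQ : Q ∈ supported S hV) (t : ℝ) :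
    covariance (fun N => diagState σ (partialDynamics 𝓛 Λ (splitFamily Λ U V) t N)) P Q = 0 :=
  sub_eq_zero.2 (diagState_partialDynamics_splitFamily_mul 𝓛 hd σ hP hQ t)

end Clustering

section Clustering

variable {Γ : Type*} [MetricSpace Γ] [DecidableEq Γ] {S : Γ → Type*} [∀ x, Fintype (S x)]
  [∀ x, DecidableEq (S x)] {𝓛 : Interaction S} {Λ X Y : Finset Γ} {F : ℝ → ℝ} {a M C t : ℝ}

theorem norm_covariance_sub_splitFamily_nbhd_le (hF : IsFFunction Γ F) (ha : 0 ≤ a)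
    (h : IsDecayBound (fun Z => cbNorm (𝓛.L Z)) Λ (fun x y => expWeight a F (dist x y)) M C)
    {ω : LocalAlg S Λ →ₗ[ℂ] ℂ} (hω : IsState ω) {hX : X ⊆ Λ} {hY : Y ⊆ Λ} {P Q : LocalAlg S Λ}
    (hP : P ∈ supported S hX) (hQ : Q ∈ supported S hY) (ht : 0 ≤ t) (r : ℝ) :
    ‖covariance (fun N => ω (dynamics 𝓛 Λ t N)) P Q - covariance (fun N =>
        ω (partialDynamics 𝓛 Λ (splitFamily Λ (nbhd Λ X r) (nbhd Λ Y r)) t N)) P Q‖ ≤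
      2 * (X.card + Y.card) * (growth M C t * (Real.exp (-(a * r)) * FFunNorm Γ F)) *
        (‖P‖ * ‖Q‖) := by
  set δ := growth M C t * (Real.exp (-(a * r)) * FFunNorm Γ F) with hδ
  have hδ0 : 0 ≤ δ := mul_nonneg (growth_nonneg h.nonneg_const ht)
    (mul_nonneg (Real.exp_pos _).le hF.FFunNorm_nonneg)
  have hXY : X ∪ Y ⊆ Λ := Finset.union_subset hX hY
  have hPQ : P * Q ∈ supported S hXY := mul_mem
    (supported_mono Finset.subset_union_left hX hXY hP)
    (supported_mono Finset.subset_union_right hY hXY hQ)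
  have happrox {W : Finset Γ} {hW : W ⊆ Λ} (hWXY : W ⊆ X ∪ Y) {N : LocalAlg S Λ}
      (hN : N ∈ supported S hW) : ‖ω (dynamics 𝓛 Λ t N) -
        ω (partialDynamics 𝓛 Λ (splitFamily Λ (nbhd Λ X r) (nbhd Λ Y r)) t N)‖ ≤
          W.card * δ * ‖N‖ := by
    rw [← map_sub, dynamics_eq_partialDynamics_univ]
    exact (hω.norm_apply_le _).trans
      (norm_partialDynamics_sub_splitFamily_nbhd_le hF ha h hWXY hN ht)
  refine (norm_covariance_sub_covariance_le (hω.norm_apply_partialDynamics_le Finset.univ ht)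
    (hω.norm_apply_partialDynamics_le _ ht) (happrox subset_rfl hPQ)
    (happrox Finset.subset_union_left hP) (happrox Finset.subset_union_right hQ)
    (by positivity)).trans ?_
  gcongr
  have hcard : ((X ∪ Y).card : ℝ) ≤ X.card + Y.card := by exact_mod_cast Finset.card_union_le X Y
  linarith [mul_le_mul_of_nonneg_right hcard hδ0]

theorem IsLocalDynamicalFixedPoint.norm_covariance_le (hF : IsFFunction Γ F) (ha : 0 ≤ a)
    (h : IsDecayBound (fun Z => cbNorm (𝓛.L Z)) Λ (fun x y => expWeight a F (dist x y)) M C)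
    {π : LocalAlg S Λ →ₗ[ℂ] ℂ} {g : ℝ → ℝ} (hπ : IsLocalDynamicalFixedPoint 𝓛 Λ π g)
    {hX : X ⊆ Λ} {hY : Y ⊆ Λ} (hXY : 0 < setDist X Y) {P Q : LocalAlg S Λ}
    (hP : P ∈ supported S hX) (hQ : Q ∈ supported S hY) (ht : 0 ≤ t) :
    ‖covariance π P Q‖ ≤ (2 * (X.card + Y.card) *
      (growth M C t * (Real.exp (-(a * (setDist X Y / 2))) * FFunNorm Γ F)) + 3 * g t) *
        (‖P‖ * ‖Q‖) := by
  obtain ⟨σ⟩ := hπ.isState.nonempty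
  have hfixed := hπ.norm_covariance_sub_le (isState_diagState σ) ht P Q
  have hdecouple := norm_covariance_sub_splitFamily_nbhd_le hF ha h (isState_diagState σ) hP hQ ht
    (setDist X Y / 2)
  rw [covariance_diagState_splitFamily_eq_zero 𝓛 (disjoint_nbhd Λ X Y) σ
    (supported_mono (subset_nbhd hX (half_pos hXY)) hX (nbhd_subset Λ X _) hP)
    (supported_mono (subset_nbhd hY (half_pos hXY)) hY (nbhd_subset Λ Y _) hQ), sub_zero]
    at hdecouple
  rw [add_mul, add_comm]
  exact norm_le_norm_sub_add _ _ |>.trans (add_le_add hfixed hdecouple)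

end Clustering

theorem integral_exp_mul_le {v t c : ℝ} (hv : 0 ≤ v) (ht : 0 ≤ t) (hc : 1 ≤ c) :
    ∫ s in 0..t, Real.exp (v * s) ≤ t + c * ∫ s in 0..t, (Real.exp (v * s) - 1) := by
  have hint : ∫ s in 0..t, (Real.exp (v * s) - 1) = (∫ s in 0..t, Real.exp (v * s)) - t := by
    rw [intervalIntegral.integral_sub (Continuous.intervalIntegrable (by fun_prop) _ _) (by simp),
      intervalIntegral.integral_const, sub_zero, smul_eq_mul, mul_one]
  have hnonneg : 0 ≤ ∫ s in 0..t, (Real.exp (v * s) - 1) :=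
    intervalIntegral.integral_nonneg ht fun s hs =>
      sub_nonneg.2 (Real.one_le_exp (mul_nonneg hv hs.1))
  linarith [le_mul_of_one_le_left hnonneg hc]

theorem nonempty_of_setDist_pos {Γ : Type*} [MetricSpace Γ] {X Y : Finset Γ}
    (h : 0 < setDist X Y) : Nonempty Γ := by
  by_contra hΓ
  rw [not_nonempty_iff] at hΓ
  exact h.ne' (Real.iInf_of_isEmpty _)

theorem growth_le {M C c t : ℝ} (hM : 0 ≤ M) (hC : 0 ≤ C) (hc : 1 ≤ c) (ht : 0 ≤ t) :
    growth M C t ≤ M * (t + c * ∫ s in 0..t, (Real.exp (M * C * s) - 1)) :=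
  mul_le_mul_of_nonneg_left (integral_exp_mul_le (mul_nonneg hM hC) ht hc) hM

end OpenSpin

end

open OpenSpin in
theorem lemma3p5_general {Γ : Type*} [MetricSpace Γ] [DecidableEq Γ]
    {S : Γ → Type*} [∀ x, Fintype (S x)] [∀ x, DecidableEq (S x)]
    {F₀ : ℝ → ℝ} (hF₀ : IsFFunction Γ F₀) {a : ℝ} (ha : 0 ≤ a)
    {Fa : ℝ → ℝ} (hFa : Fa = expWeight a F₀)
    {𝓛 : Interaction S} (h𝓛 : HasFiniteFNorm 𝓛 Fa)
    {Λ : Finset Γ} {π : LocalAlg S Λ →ₗ[ℂ] ℂ} {g : ℝ → ℝ}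
    (hπ : IsLocalDynamicalFixedPoint 𝓛 Λ π g)
    {X Y : Finset Γ} (hX : X ⊆ Λ) (hY : Y ⊆ Λ) (hXY : 0 < setDist X Y)
    (A : LocalAlg S X) (B : LocalAlg S Y)
    {v : ℝ} (hv : v = FNorm 𝓛 Fa * convConst Γ Fa) {t : ℝ} (ht : 0 ≤ t) :
    ‖π (embed hX A * embed hY B)
        - π (embed hX A) * π (embed hY B)‖ ≤
      2 * ‖A‖ * ‖B‖ * ((X.card : ℝ) + (Y.card : ℝ))
          * FNorm 𝓛 Fa * FFunNorm Γ F₀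
          * (t + (convConst Γ Fa + FFunNorm Γ Fa) / convConst Γ Fa
              * ∫ s in (0 : ℝ)..t, (Real.exp (v * s) - 1))
          * Real.exp (-(a * setDist X Y / 2))
        + 3 * ‖A‖ * ‖B‖ * g t := by
  have : Nonempty Γ := nonempty_of_setDist_pos hXY
  have hFFa : IsFFunction Γ Fa := hFa ▸ isFFunction_expWeight hF₀ ha
  have hbound := isDecayBound_cbNorm hFFa h𝓛 Λ
  have hratio : 1 ≤ (convConst Γ Fa + FFunNorm Γ Fa) / convConst Γ Fa :=
    (one_le_div hFFa.convConst_pos).2 (le_add_of_nonneg_right hFFa.FFunNorm_nonneg)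
  have hF₀_nonneg : 0 ≤ FFunNorm Γ F₀ := hF₀.FFunNorm_nonneg
  have hg : 0 ≤ g t := (hπ.range t ht).1
  have hgrowth := growth_le hbound.nonneg_const hFFa.convConst_pos.le hratio ht
  set I := FNorm 𝓛 Fa * (t + (convConst Γ Fa + FFunNorm Γ Fa) / convConst Γ Fa *
    ∫ s in (0 : ℝ)..t, (Real.exp (FNorm 𝓛 Fa * convConst Γ Fa * s) - 1)) with hI
  calc ‖covariance π (embed hX A) (embed hY B)‖
      ≤ (2 * (X.card + Y.card) * (growth (FNorm 𝓛 Fa) (convConst Γ Fa) t *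
          (Real.exp (-(a * (setDist X Y / 2))) * FFunNorm Γ F₀)) + 3 * g t) *
            (‖embed hX A‖ * ‖embed hY B‖) :=
        hπ.norm_covariance_le hF₀ ha (hFa ▸ hbound) hXY (mem_supported.2 ⟨A, rfl⟩)
          (mem_supported.2 ⟨B, rfl⟩) ht
    _ ≤ (2 * (X.card + Y.card) * (I * (Real.exp (-(a * (setDist X Y / 2))) * FFunNorm Γ F₀)) +
          3 * g t) * (‖A‖ * ‖B‖) := by
        gcongr
        · have := (growth_nonneg (C := convConst Γ Fa) hbound.nonneg_const ht).trans hgrowth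
          positivity
        · exact norm_embed_le hX A
        · exact norm_embed_le hY B
    _ = _ := by
        rw [hI, hv, mul_div_assoc]
        ring

theorem lemma3p5 {Γ : Type*} [MetricSpace Γ] [Countable Γ] [DecidableEq Γ]
    (S : Γ → Type*) [∀ x, Fintype (S x)] [∀ x, DecidableEq (S x)] [∀ x, Nonempty (S x)]
    (F₀ : ℝ → ℝ) (hF₀ : OpenSpin.IsFFunction Γ F₀)
    (a : ℝ) (ha : 0 < a)
    (Fa : ℝ → ℝ) (hFa : Fa = OpenSpin.expWeight a F₀)
    (𝓛 : OpenSpin.Interaction S)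
    (h𝓛 : OpenSpin.HasFiniteFNorm 𝓛 Fa) (h𝓛0 : OpenSpin.FNorm 𝓛 Fa ≠ 0)
    (Λ : Finset Γ) (π : OpenSpin.LocalAlg S Λ →ₗ[ℂ] ℂ) (g : ℝ → ℝ)
    (hπ : OpenSpin.IsLocalDynamicalFixedPoint 𝓛 Λ π g)
    (X Y : Finset Γ) (hX : X ⊆ Λ) (hY : Y ⊆ Λ) (hXne : X.Nonempty) (hYne : Y.Nonempty)
    (hXY : 2 < OpenSpin.setDist X Y)
    (A : OpenSpin.LocalAlg S X) (B : OpenSpin.LocalAlg S Y)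
    (v t : ℝ) (hv : v = OpenSpin.FNorm 𝓛 Fa * OpenSpin.convConst Γ Fa)
    (ht : t = a * OpenSpin.setDist X Y / (4 * v)) :
    ‖π (OpenSpin.embed hX A * OpenSpin.embed hY B)
        - π (OpenSpin.embed hX A) * π (OpenSpin.embed hY B)‖ ≤
      2 * ‖A‖ * ‖B‖ * ((X.card : ℝ) + (Y.card : ℝ))
          * OpenSpin.FNorm 𝓛 Fa * OpenSpin.FFunNorm Γ F₀
          * (t + (OpenSpin.convConst Γ Fa + OpenSpin.FFunNorm Γ Fa) / OpenSpin.convConst Γ Fa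
              * ∫ s in (0 : ℝ)..t, (Real.exp (v * s) - 1))
          * Real.exp (-(a * OpenSpin.setDist X Y / 2))
        + 3 * ‖A‖ * ‖B‖ * g t := by
  have hv_nonneg : 0 ≤ v :=
    hv ▸ mul_nonneg (OpenSpin.FNorm_nonneg (hFa ▸ OpenSpin.isFFunction_expWeight hF₀ ha.le))
      (OpenSpin.convConst_nonneg Γ Fa)
  have hd_pos : 0 < OpenSpin.setDist X Y := two_pos.trans hXY
  exact lemma3p5_general hF₀ ha.le hFa h𝓛 hπ hX hY hd_pos A B hv (ht ▸ by positivity)
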